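/- Let $a,b\in\mathbb R^3$ with $a_i<b_i$, let $B=\prod_{i}[a_i,b_i]$, let $\phi:\mathbb R^3\to\mathbb R$ be continuous, and let $\Omega=\{x\in B:\phi(x)=0\}$ be the mid-surface of a shell. Assume that on an open set $U\supseteq\Omega$ the function $\phi$ is $C^2$ with $\nabla\phi\neq0$, and that $\Omega$ is transversal to $\partial B$: at every $x\in\Omega$ the gradient $\nabla\phi(x)$ is not in the span of the normals of the faces of $B$ containing $x$. Let $\Gamma=\Omega\cap\partial B$ be the boundary curve and $\mu$ its outward unit conormal (tangent to $\Omega$, normal to $\Gamma$, pointing out of $\Omega$; it is defined off the finitely many points of $\Gamma$ on edges of $B$). Put $$n=\frac{\nabla\phi}{\|\nabla\phi\|},\qquad P=I-n\otimes n,\qquad H=-\nabla n\cdot P,\qquad \operatorname{div}T=\nabla T:P+(\operatorname{tr}H)\,T\cdot n$$ for a second order tensor field $T$, where $\nabla T=\partial_kT\otimes e^k$, and $[T]_\times=T_{ij}\,e^i\times e^j$ for $T=T_{ij}\,e^i\otimes e^j$. Let $N$, $M$ (second order tensor fields) and $S$ (a vector field) be $C^1$ on $U$ and tangential on $\Omega$,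 that is $PNP=N$, $PMP=M$ and $S\cdot n=0$ on $\Omega$. Let $\sigma=N+n\otimes S$ be the stress tensor, $t=\sigma\cdot\mu$ the traction and $m=n\times(M\cdot\mu)$ the moment vector on $\Gamma$, and let the surface load $f:\mathbb R^3\to\mathbb R^3$ satisfy the local equilibrium of forces $\operatorname{div}\sigma+f=0$ on $\Omega$. Suppose that on $\Omega$ $$S=P\cdot\operatorname{div}(M)$$ and that at least one of the following holds: 1. $M$ is symmetric and $[-H\cdot M+N^\top]_\times=0$ on $\Omega$; 2. $[-H\cdot M^\top+N^\top]_\times=0$ on $\Omega$ ($M$ not necessarily symmetric). Then the equilibrium of moments holds: both integrals below converge absolutely and $$\int_\Gamma\bigl(m+x\times t\bigr)\,ds+\int_\Omega x\times f\,dA=0 .$$ -/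

import Mathlib

open MeasureTheory Set
open scoped RealInnerProductSpace

namespace Shell

noncomputable section

/-- Euclidean three-space. -/
abbrev E3 : Type := EuclideanSpace ℝ (Fin 3)

/-- Second order tensors `T = T_ij e^i ⊗ e^j`, acting on vectors by `v ↦ T · v`. -/
abbrev Tensor2 : Type := E3 →L[ℝ] E3

/-- The standard Cartesian basis vectors. -/
def e (i : Fin 3) : E3 := EuclideanSpace.single i 1

/-- The dyad `u ⊗ v`, that is `w ↦ (v · w) u`. -/
def dyad (u v : E3) : Tensor2 := (innerSL ℝ v).smulRight u

/-- The transpose of a tensor. -/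
def transp (T : Tensor2) : Tensor2 := ContinuousLinearMap.adjoint T

/-- The cross product on Euclidean three-space. -/
def cross (u v : E3) : E3 := WithLp.toLp 2 (crossProduct (WithLp.ofLp u) (WithLp.ofLp v))

/-- `[T]_× = T_ij e^i × e^j`, where `T_ij = e_i · (T · e_j)`. -/
def crossVec (T : Tensor2) : E3 := ∑ i, ∑ j, (T (e j)) i • cross (e i) (e j)

/-! ### Geometry of the implicitly defined mid-surface -/

/-- The closed cuboid `[a₀, b₀] × [a₁, b₁] × [a₂, b₂]`. -/
def cuboid (a b : E3) : Set E3 := {x | ∀ i, a i ≤ x i ∧ x i ≤ b i}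

/-- The mid-surface `Ω`: the zero level set of `φ` inside the cuboid. -/
def midSurface (φ : E3 → ℝ) (a b : E3) : Set E3 := {x | x ∈ cuboid a b ∧ φ x = 0}

/-- The boundary `Γ` of the mid-surface: its part on the boundary of the cuboid. -/
def boundaryCurve (φ : E3 → ℝ) (a b : E3) : Set E3 :=
  midSurface φ a b ∩ frontier (cuboid a b)

/-- The mid-surface is transversal to the boundary of the cuboid: at none of its points is the
gradient of `φ` a linear combination of the normals of the faces of the cuboid through that
point (equivalently, `∇φ(x)` and these normals are linearly independent). -/
def Transversal (φ : E3 → ℝ) (a b : E3) : Prop :=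
  ∀ x ∈ midSurface φ a b,
    gradient φ x ∉ Submodule.span ℝ {v : E3 | ∃ i, (x i = a i ∨ x i = b i) ∧ v = e i}

/-- The unit normal `n = ∇φ / ‖∇φ‖`. -/
def unitNormal (φ : E3 → ℝ) (x : E3) : E3 := ‖gradient φ x‖⁻¹ • gradient φ x

/-- The tangential projector `P = I - n ⊗ n`. -/
def projector (φ : E3 → ℝ) (x : E3) : Tensor2 :=
  ContinuousLinearMap.id ℝ E3 - dyad (unitNormal φ x) (unitNormal φ x)

/-- The extended Weingarten map `H = -∇n · P`. -/
def weingarten (φ : E3 → ℝ) (x : E3) : Tensor2 :=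
  -((fderiv ℝ (unitNormal φ) x).comp (projector φ x))

/-- The mean curvature `H = tr H`, the trace of the Weingarten map. -/
def meanCurvature (φ : E3 → ℝ) (x : E3) : ℝ := ∑ i, (weingarten φ x (e i)) i

/-- The surface divergence `div T = ∇T : P + H T · n` of a second order tensor field, where
`∇T = T_{,k} ⊗ e^k`, so that `∇T : P = T_{,k} · (P · e_k)`. -/
def surfaceDiv (φ : E3 → ℝ) (T : E3 → Tensor2) (x : E3) : E3 :=
  (∑ k, (fderiv ℝ T x (e k)) (projector φ x (e k)))
    + meanCurvature φ x • T x (unitNormal φ x)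

/-- The outward normal of the cuboid at a boundary point (not normalized). On the relative
interior of a face it is the outward unit normal of that face; where faces meet it is the sum of
their outward unit normals. -/
def cuboidNormal (a b x : E3) : E3 :=
  ∑ i, (if x i = b i then (1 : ℝ) else if x i = a i then -1 else 0) • e i

/-- The outward unit conormal `μ` along `Γ`: tangential to the surface and normal to `Γ`,
obtained by projecting the outward normal of the cuboid to the tangent plane and normalizing.
Only the points of `Γ` on the edges of the cuboid, where `Γ` may have a corner, carry an
arbitrary choice; for a transversal surface there are finitely many of them. -/
def conormal (φ : E3 → ℝ) (a b x : E3) : E3 :=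
  ‖projector φ x (cuboidNormal a b x)‖⁻¹ • projector φ x (cuboidNormal a b x)

/-! ### Stress and moment tensors -/

/-- A tensor field is tangential on a set: `P · T · P = T`,
that is `T = T^{αβ} a_α ⊗ a_β` with tangent vectors `a_α`. -/
def TangentialOn (φ : E3 → ℝ) (T : E3 → Tensor2) (s : Set E3) : Prop :=
  ∀ x ∈ s, (projector φ x).comp ((T x).comp (projector φ x)) = T x

/-- The stress tensor `σ = N + n ⊗ S`. -/
def stress (φ : E3 → ℝ) (N : E3 → Tensor2) (S : E3 → E3) (x : E3) : Tensor2 :=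
  N x + dyad (unitNormal φ x) (S x)

/-- The boundary traction `t(μ) = σ · μ`. -/
def traction (φ : E3 → ℝ) (a b : E3) (N : E3 → Tensor2) (S : E3 → E3) (x : E3) : E3 :=
  stress φ N S x (conormal φ a b x)

/-- The boundary moment `m(μ) = n × (M · μ)`. -/
def boundaryMoment (φ : E3 → ℝ) (a b : E3) (M : E3 → Tensor2) (x : E3) : E3 :=
  cross (unitNormal φ x) (M x (conormal φ a b x))

/-- The local equilibrium of forces `div σ + f = 0` on the mid-surface. -/
def ForceEquilibrium (φ : E3 → ℝ) (a b : E3) (N : E3 → Tensor2) (S f : E3 → E3) : Prop :=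
  ∀ x ∈ midSurface φ a b, surfaceDiv φ (stress φ N S) x + f x = 0

/-- The equilibrium of moments `∫_Γ (m + x × t) ds + ∫_Ω x × f dA = 0`
(length and area measure), the two integrals being absolutely convergent. -/
def MomentEquilibrium (φ : E3 → ℝ) (a b : E3) (N M : E3 → Tensor2) (S f : E3 → E3) : Prop :=
  IntegrableOn (fun x => boundaryMoment φ a b M x + cross x (traction φ a b N S x))
      (boundaryCurve φ a b) μHE[1] ∧
    IntegrableOn (fun x => cross x (f x)) (midSurface φ a b) μHE[2] ∧
    (∫ x in boundaryCurve φ a b,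
        (boundaryMoment φ a b M x + cross x (traction φ a b N S x)) ∂μHE[1])
      + (∫ x in midSurface φ a b, cross x (f x) ∂μHE[2]) = 0

end

end Shell

/-!
The total moment is the flux of a tensor field through the boundary curve: with
`Q · v = n × (M · v) + x × (σ · v)` one has `Q · μ = m + x × t`. A divergence theorem on the surface turns
the flux into `∫_Ω div Q dA`, and `div Q = -x × f` pointwise: the product rule produces
`x × div σ = -x × f`, the couple `n × div M = n × S`, the couple `S × n` from the transverse part of
`σ`, which cancels it, and the couples `∂_k n × M P e_k` and `e_k × N e_k`, which add up to
`[-H · Mᵀ + Nᵀ]_×`. Both alternatives of the theorem say that this last vector vanishes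
(`surfaceDiv_momentTensor_eq`).

The divergence theorem (`setIntegral_apply_conormal_eq_setIntegral_surfaceDiv`) is Stokes' theorem
for the vector fields `A = n × (Tᵀ · c)`, because `A · (n × μ) = c · T μ` and
`curl A · n = c · div T`. Stokes' theorem (`stokesDefect_eq_zero`) is reduced to fields supported in
one chart by cutting off the field step by step along a finite cover of the compact surface. In a
chart it is the divergence theorem on a rectangle (`GraphChart.stokes`). The charts come from
transversality: at each point of the surface some coordinate axis is neither tangent to the surface
nor normal to a face of the cuboid through that point, so that the surface is a graph over the two
other coordinates, and the part of it inside the cuboid is a graph over part of a rectangle whose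
edges correspond to the boundary curve.

The link between these coordinate computations and the Hausdorff measures in the statement is the
area formula (`euclideanHausdorffMeasure_image_eq_lintegral_normDet`). Near each point a `C¹`
immersion agrees with its derivative up to a bi-Lipschitz map with constant close to one, so the
Hausdorff measure of a small piece is close to the Jacobian times the Lebesgue measure of its
preimage.
-/

namespace Shell

/-! ### The area formula for embedded surfaces and curves -/

section AreaFormula

open Measure Topology Module Filter
open scoped NNReal ENNReal

/-- If `f` expands distances at most `K` times as much as `g` does, then the image under `f` is a
`K`-Lipschitz image of the image under `g`. -/
theorem euclideanHausdorffMeasure_image_le_of_dist_le {X Y Z : Type*}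
    [MetricSpace Y] [MeasurableSpace Y] [BorelSpace Y]
    [MetricSpace Z] [MeasurableSpace Z] [BorelSpace Z]
    {f : X → Y} {g : X → Z} {A : Set X} {K : ℝ≥0} (d : ℕ)
    (h : ∀ y ∈ A, ∀ z ∈ A, dist (f y) (f z) ≤ K * dist (g y) (g z)) :
    μHE[d] (f '' A) ≤ (K : ℝ≥0∞) ^ d * μHE[d] (g '' A) := by
  rcases A.eq_empty_or_nonempty with rfl | ⟨x₀, -⟩
  · simp
  have : Nonempty X := ⟨x₀⟩
  have himg : f '' A = (f ∘ Function.invFunOn g A) '' (g '' A) := by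
    rw [image_image]
    refine image_congr fun y hy => ?_
    have h1 := Function.invFunOn_mem (f := g) (s := A) ⟨y, hy, rfl⟩
    have h2 := Function.invFunOn_eq (f := g) (s := A) ⟨y, hy, rfl⟩
    have h3 := h y hy _ h1
    rw [h2, dist_self, mul_zero] at h3
    exact dist_le_zero.1 h3
  have hlip : LipschitzOnWith K (f ∘ Function.invFunOn g A) (g '' A) := by
    refine LipschitzOnWith.of_dist_le_mul ?_
    rintro _ ⟨y, hy, rfl⟩ _ ⟨z, hz, rfl⟩
    have := h _ (Function.invFunOn_mem (f := g) (s := A) ⟨y, hy, rfl⟩) _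
      (Function.invFunOn_mem (f := g) (s := A) ⟨z, hz, rfl⟩)
    rwa [Function.invFunOn_eq (f := g) (s := A) ⟨y, hy, rfl⟩,
      Function.invFunOn_eq (f := g) (s := A) ⟨z, hz, rfl⟩] at this
  have := hlip.hausdorffMeasure_image_le (d := d) (by positivity)
  rw [himg, euclideanHausdorffMeasure_def, euclideanHausdorffMeasure_def]
  simp only [Measure.smul_apply, ENNReal.smul_def, smul_eq_mul]
  rw [mul_left_comm]
  gcongr
  simpa using this

/-- An inequality between measures is a local property: a countable subcover is made disjoint. -/
theorem measure_le_of_forall_nhds {X : Type*} [TopologicalSpace X] [SecondCountableTopology X]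
    [MeasurableSpace X] [OpensMeasurableSpace X] {μ ν : Measure X} {D : Set X}
    (h : ∀ x ∈ D, ∃ s ∈ 𝓝 x, ∀ A ⊆ s ∩ D, MeasurableSet A → μ A ≤ ν A)
    {A : Set X} (hA : MeasurableSet A) (hAD : A ⊆ D) : μ A ≤ ν A := by
  have h' : ∀ x : X, ∃ s : Set X, IsOpen s ∧ (x ∈ D → x ∈ s) ∧
      ∀ A ⊆ s ∩ D, MeasurableSet A → μ A ≤ ν A := by
    intro x
    by_cases hx : x ∈ D
    · obtain ⟨s, hs, H⟩ := h x hx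
      obtain ⟨t, hts, hto, hxt⟩ := mem_nhds_iff.1 hs
      exact ⟨t, hto, fun _ => hxt, fun A hAt => H A (hAt.trans (by gcongr))⟩
    · refine ⟨∅, isOpen_empty, fun h => (hx h).elim, fun A hA _ => ?_⟩
      have : A = ∅ := by simpa using hA
      simp [this]
  choose s hso hxs hs using h'
  obtain ⟨t, -, htc, htD⟩ := TopologicalSpace.countable_cover_nhdsWithin (s := D) (f := s)
    fun x hx => mem_nhdsWithin_of_mem_nhds ((hso x).mem_nhds (hxs x hx))
  rcases t.eq_empty_or_nonempty with rfl | hne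
  · have : A = ∅ := by
      have := hAD.trans htD
      simpa using this
    simp [this]
  obtain ⟨u, rfl⟩ := htc.exists_eq_range hne
  have hcov : A = ⋃ n, A ∩ disjointed (fun n => s (u n)) n := by
    rw [← inter_iUnion, iUnion_disjointed, eq_comm, inter_eq_left]
    refine (hAD.trans htD).trans ?_
    simp
  have hmeas : ∀ n, MeasurableSet (A ∩ disjointed (fun n => s (u n)) n) := fun n =>
    hA.inter (MeasurableSet.disjointed (fun n => (hso (u n)).measurableSet) n)
  have hdisj : Pairwise (Function.onFun Disjoint fun n => A ∩ disjointed (fun n => s (u n)) n) :=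
    fun i j hij => (disjoint_disjointed _ hij).mono inter_subset_right inter_subset_right
  rw [hcov, measure_iUnion hdisj hmeas, measure_iUnion hdisj hmeas]
  refine ENNReal.tsum_le_tsum fun n => hs (u n) _ ?_ (hmeas n)
  exact fun x hx => ⟨disjointed_subset (fun n => s (u n)) n hx.2, hAD hx.1⟩

theorem le_of_forall_one_lt_le_mul {a b : ℝ≥0∞} (h : ∀ K : ℝ≥0, 1 < K → a ≤ K * b) : a ≤ b := by
  by_cases hb : b = ∞
  · simp [hb]
  have h1 : Tendsto (fun K : ℝ≥0 => (K : ℝ≥0∞) * b) (𝓝[>] 1) (𝓝 (1 * b)) :=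
    (ENNReal.Tendsto.mul_const (ENNReal.tendsto_coe.2 (tendsto_id.mono_left nhdsWithin_le_nhds))
      (Or.inr hb))
  rw [one_mul] at h1
  exact ge_of_tendsto h1 (eventually_mem_nhdsWithin.mono fun K hK => h K hK)

theorem continuous_normDet {E F : Type*} [NormedAddCommGroup E] [InnerProductSpace ℝ E]
    [FiniteDimensional ℝ E] [NormedAddCommGroup F] [InnerProductSpace ℝ F] :
    Continuous fun L : E →L[ℝ] F => (L : E →ₗ[ℝ] F).normDet := by
  have h : (fun L : E →L[ℝ] F => (L : E →ₗ[ℝ] F).normDet) = fun L : E →L[ℝ] F =>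
      √(Matrix.of fun i j =>
        ⟪L (stdOrthonormalBasis ℝ E i), L (stdOrthonormalBasis ℝ E j)⟫).det := by
    funext L
    have := (L : E →ₗ[ℝ] F).normDet_sq_eq_det_gram (stdOrthonormalBasis ℝ E)
    simp only [RCLike.ofReal_real_eq_id, id_eq] at this
    rw [← Real.sqrt_sq (LinearMap.normDet_nonneg _), this]
    rfl
  rw [h]
  refine Real.continuous_sqrt.comp (Continuous.matrix_det ?_)
  refine continuous_matrix fun i j => ?_
  simp only [Matrix.of_apply]
  fun_prop

variable {E F : Type*} [NormedAddCommGroup E] [InnerProductSpace ℝ E] [FiniteDimensional ℝ E]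
  [MeasurableSpace E] [BorelSpace E] [NormedAddCommGroup F] [InnerProductSpace ℝ F]
  [MeasurableSpace F] [BorelSpace F]

/-- Near a point where the derivative `L` is injective, a `C¹` map differs from `L` by a
bi-Lipschitz change of variables with constant as close to one as desired. -/
theorem exists_nhds_measure_image_comparable {G : E → F} {x : E}
    (hG : ContDiffAt ℝ 1 G x) (hinj : Function.Injective (fderiv ℝ G x))
    {K : ℝ≥0} (hK : 1 < K) :
    ∃ s ∈ 𝓝 x, ∀ A ⊆ s, MeasurableSet A →
      μHE[finrank ℝ E] (G '' A)
        ≤ K * ∫⁻ y in A, ENNReal.ofReal ((fderiv ℝ G y : E →ₗ[ℝ] F).normDet) ∧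
      ∫⁻ y in A, ENNReal.ofReal ((fderiv ℝ G y : E →ₗ[ℝ] F).normDet)
        ≤ K * μHE[finrank ℝ E] (G '' A) := by
  set L := fderiv ℝ G x with hL
  set d := finrank ℝ E
  -- `d` of the factors `κ` go to the distortion of distances, one to the variation of the Jacobian
  obtain ⟨κ, hκ1, hκK⟩ : ∃ κ : ℝ≥0, 1 < κ ∧ κ ^ (d + 1) = K := by
    refine ⟨K ^ ((d + 1 : ℝ)⁻¹), NNReal.one_lt_rpow hK (by positivity), ?_⟩
    rw [← NNReal.rpow_natCast, ← NNReal.rpow_mul]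
    push_cast
    rw [inv_mul_cancel₀ (by positivity), NNReal.rpow_one]
  have hκ0 : (0 : ℝ) < κ := by exact_mod_cast zero_lt_one.trans hκ1
  have hκ1' : (1 : ℝ) < κ := by exact_mod_cast hκ1
  obtain ⟨C, hC, hanti⟩ : ∃ C > 0, AntilipschitzWith C L :=
    (L : E →ₗ[ℝ] F).exists_antilipschitzWith (LinearMap.ker_eq_bot.2 hinj)
  -- the defect `G y - G z - L (y - z)` is to be at most `1 - κ⁻¹` times `L (y - z)`
  set ε : ℝ := 1 - (κ : ℝ)⁻¹ with hε
  have hε0 : 0 < ε := sub_pos.2 (inv_lt_one_of_one_lt₀ hκ1')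
  have hstrict : HasStrictFDerivAt G L x := hG.hasStrictFDerivAt one_ne_zero
  have hJ0 : 0 < (L : E →ₗ[ℝ] F).normDet := by
    refine lt_of_le_of_ne (LinearMap.normDet_nonneg _) (Ne.symm ?_)
    exact (((L : E →ₗ[ℝ] F).normDet_ne_zero_tfae).out 0 4).2 hinj
  have hJc : ContinuousAt (fun y => (fderiv ℝ G y : E →ₗ[ℝ] F).normDet) x :=
    continuous_normDet.continuousAt.comp (hG.continuousAt_fderiv one_ne_zero)
  have hJ1 : ∀ᶠ y in 𝓝 x, (fderiv ℝ G y : E →ₗ[ℝ] F).normDet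
      < κ * (L : E →ₗ[ℝ] F).normDet :=
    hJc.eventually (gt_mem_nhds (by nlinarith))
  have hJ2 : ∀ᶠ y in 𝓝 x, (κ : ℝ)⁻¹ * (L : E →ₗ[ℝ] F).normDet
      < (fderiv ℝ G y : E →ₗ[ℝ] F).normDet :=
    hJc.eventually (lt_mem_nhds (by
      have := inv_lt_one_of_one_lt₀ hκ1'
      nlinarith))
  obtain ⟨s, hs, happ⟩ := hstrict.approximates_deriv_on_nhds (c := ε.toNNReal / C)
    (Or.inr (div_pos (Real.toNNReal_pos.2 hε0) hC))
  refine ⟨s ∩ {y | (fderiv ℝ G y : E →ₗ[ℝ] F).normDet < κ * (L : E →ₗ[ℝ] F).normDet ∧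
      (κ : ℝ)⁻¹ * (L : E →ₗ[ℝ] F).normDet < (fderiv ℝ G y : E →ₗ[ℝ] F).normDet},
    inter_mem hs (hJ1.and hJ2), fun A hA hAm => ?_⟩
  have hdef : ∀ y ∈ A, ∀ z ∈ A, ‖G y - G z - L (y - z)‖ ≤ ε * ‖L (y - z)‖ := by
    intro y hy z hz
    have h1 := happ y (hA hy).1 z (hA hz).1
    have h2 : ‖y - z‖ ≤ C * ‖L (y - z)‖ := by
      have := hanti.le_mul_dist y z
      rwa [dist_eq_norm, dist_eq_norm, ← map_sub] at this
    have hC' : (0 : ℝ) < C := by exact_mod_cast hC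
    rw [NNReal.coe_div, Real.coe_toNNReal _ hε0.le] at h1
    calc _ ≤ ε / C * ‖y - z‖ := h1
      _ ≤ ε / C * (C * ‖L (y - z)‖) := by gcongr
      _ = ε * ‖L (y - z)‖ := by field_simp
  have hε1 : 1 + ε ≤ κ := by
    have : (κ : ℝ) * (κ : ℝ)⁻¹ = 1 := mul_inv_cancel₀ hκ0.ne'
    have : 0 < (κ : ℝ)⁻¹ := by positivity
    nlinarith
  have hup : μHE[d] (G '' A) ≤ (κ : ℝ≥0∞) ^ d * μHE[d] ((L : E →ₗ[ℝ] F) '' A) := by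
    refine euclideanHausdorffMeasure_image_le_of_dist_le d fun y hy z hz => ?_
    rw [dist_eq_norm, dist_eq_norm, ← map_sub]
    have h1 := hdef y hy z hz
    have h2 := norm_add_le (G y - G z - L (y - z)) (L (y - z))
    rw [sub_add_cancel] at h2
    calc ‖G y - G z‖ ≤ (1 + ε) * ‖L (y - z)‖ := by linarith
      _ ≤ κ * ‖L (y - z)‖ := by gcongr
  have hlow : μHE[d] ((L : E →ₗ[ℝ] F) '' A) ≤ (κ : ℝ≥0∞) ^ d * μHE[d] (G '' A) := by
    refine euclideanHausdorffMeasure_image_le_of_dist_le d fun y hy z hz => ?_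
    rw [dist_eq_norm, dist_eq_norm, ← map_sub]
    have h1 := hdef y hy z hz
    have h2 := norm_sub_norm_le (L (y - z)) (G y - G z)
    rw [norm_sub_rev (L (y - z))] at h2
    have h3 : (κ : ℝ)⁻¹ * ‖L (y - z)‖ ≤ ‖G y - G z‖ := by rw [hε] at h1; linarith
    calc ‖L (y - z)‖ = κ * ((κ : ℝ)⁻¹ * ‖L (y - z)‖) := by field_simp
      _ ≤ κ * ‖G y - G z‖ := by gcongr
  rw [(L : E →ₗ[ℝ] F).euclideanHausdorffMeasure_image_eq_normDet_mul_volume] at hup hlow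
  have hconst : ∀ c : ℝ≥0∞, ∫⁻ _ in A, c = c * volume A := fun c => by simp
  have e1 : ENNReal.ofReal (L : E →ₗ[ℝ] F).normDet * volume A
      ≤ κ * ∫⁻ y in A, ENNReal.ofReal ((fderiv ℝ G y : E →ₗ[ℝ] F).normDet) := by
    rw [← hconst, ← lintegral_const_mul' _ _ ENNReal.coe_ne_top]
    refine setLIntegral_mono' hAm fun y hy => ?_
    rw [← ENNReal.ofReal_coe_nnreal, ← ENNReal.ofReal_mul hκ0.le]
    refine ENNReal.ofReal_le_ofReal ?_
    have := (hA hy).2.2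
    calc (L : E →ₗ[ℝ] F).normDet = κ * ((κ : ℝ)⁻¹ * (L : E →ₗ[ℝ] F).normDet) := by field_simp
      _ ≤ _ := by gcongr
  have e2 : ∫⁻ y in A, ENNReal.ofReal ((fderiv ℝ G y : E →ₗ[ℝ] F).normDet)
      ≤ κ * (ENNReal.ofReal (L : E →ₗ[ℝ] F).normDet * volume A) := by
    rw [← mul_assoc, ← hconst]
    refine setLIntegral_mono' hAm fun y hy => ?_
    rw [← ENNReal.ofReal_coe_nnreal, ← ENNReal.ofReal_mul hκ0.le]
    exact ENNReal.ofReal_le_ofReal (hA hy).2.1.le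
  have hKe : (K : ℝ≥0∞) = κ ^ d * κ := by rw [← hκK, pow_succ]; push_cast; rfl
  constructor
  · calc _ ≤ _ := hup
      _ ≤ κ ^ d * (κ * _) := by gcongr
      _ = _ := by rw [hKe, mul_assoc]
  · calc _ ≤ _ := e2
      _ ≤ κ * (κ ^ d * _) := by gcongr
      _ = _ := by rw [hKe, ← mul_assoc, mul_comm (κ : ℝ≥0∞)]

/-- **Area formula** for an injective `C¹` immersion. -/
theorem euclideanHausdorffMeasure_image_eq_lintegral_normDet {G : E → F} {D A : Set E}
    (hD : IsOpen D) (hG : ContDiffOn ℝ 1 G D) (hGinj : InjOn G D)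
    (himm : ∀ y ∈ D, Function.Injective (fderiv ℝ G y)) (hA : MeasurableSet A) (hAD : A ⊆ D) :
    μHE[finrank ℝ E] (G '' A)
      = ∫⁻ y in A, ENNReal.ofReal ((fderiv ℝ G y : E →ₗ[ℝ] F).normDet) := by
  have hemb : MeasurableEmbedding (D.domRestrict G) :=
    hG.continuousOn.measurableEmbedding hD.measurableSet hGinj
  set ν : Measure E := (comap (D.domRestrict G) μHE[finrank ℝ E]).map (Subtype.val : D → E)
  set J : E → ℝ≥0∞ := fun y => ENNReal.ofReal ((fderiv ℝ G y : E →ₗ[ℝ] F).normDet)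
  have hν : ∀ B ⊆ D, MeasurableSet B → ν B = μHE[finrank ℝ E] (G '' B) := by
    intro B hB hBm
    rw [Measure.map_apply measurable_subtype_coe hBm, hemb.comap_apply]
    congr 1
    ext z
    constructor
    · rintro ⟨y, hy, rfl⟩
      exact ⟨y, hy, rfl⟩
    · rintro ⟨y, hy, rfl⟩
      exact ⟨⟨y, hB hy⟩, hy, rfl⟩
  have key : ∀ K : ℝ≥0, 1 < K → ν A ≤ ((K : ℝ≥0∞) • volume.withDensity J) A ∧
      volume.withDensity J A ≤ ((K : ℝ≥0∞) • ν) A := by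
    intro K hK
    have hloc := fun x (hx : x ∈ D) => exists_nhds_measure_image_comparable
      (hG.contDiffAt (hD.mem_nhds hx)) (himm x hx) hK
    constructor
    · refine measure_le_of_forall_nhds (D := D) (fun x hx => ?_) hA hAD
      obtain ⟨s, hs, H⟩ := hloc x hx
      refine ⟨s, hs, fun B hB hBm => ?_⟩
      rw [hν B (hB.trans inter_subset_right) hBm, Measure.smul_apply, withDensity_apply _ hBm]
      exact (H B (hB.trans inter_subset_left) hBm).1
    · refine measure_le_of_forall_nhds (D := D) (fun x hx => ?_) hA hAD
      obtain ⟨s, hs, H⟩ := hloc x hx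
      refine ⟨s, hs, fun B hB hBm => ?_⟩
      rw [Measure.smul_apply, hν B (hB.trans inter_subset_right) hBm, withDensity_apply _ hBm]
      exact (H B (hB.trans inter_subset_left) hBm).2
  rw [← hν A hAD hA, ← withDensity_apply _ hA]
  exact le_antisymm (le_of_forall_one_lt_le_mul fun K hK => (key K hK).1)
    (le_of_forall_one_lt_le_mul fun K hK => (key K hK).2)

/-- Change of variables in a surface integral: the area formula for Bochner integrals. -/
theorem setIntegral_image_eq_setIntegral_normDet_smul {V : Type*} [NormedAddCommGroup V]
    [NormedSpace ℝ V] {G : E → F} {D A : Set E}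
    (hD : IsOpen D) (hG : ContDiffOn ℝ 1 G D) (hGinj : InjOn G D)
    (himm : ∀ y ∈ D, Function.Injective (fderiv ℝ G y)) (hA : MeasurableSet A) (hAD : A ⊆ D)
    (h : F → V) :
    ∫ x in G '' A, h x ∂μHE[finrank ℝ E]
      = ∫ y in A, (fderiv ℝ G y : E →ₗ[ℝ] F).normDet • h (G y) := by
  have hemb : MeasurableEmbedding (A.domRestrict G) :=
    (hG.continuousOn.mono hAD).measurableEmbedding hA (hGinj.mono hAD)
  set J : E → ℝ := fun y => (fderiv ℝ G y : E →ₗ[ℝ] F).normDet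
  have hJm : AEMeasurable (fun y => (J y).toNNReal) (volume.restrict A) := by
    refine measurable_real_toNNReal.comp_aemeasurable ?_
    refine ContinuousOn.aemeasurable ?_ hA
    exact continuous_normDet.comp_continuousOn
      ((hG.continuousOn_fderiv_of_isOpen hD le_rfl).mono hAD)
  have hmap : Measure.map (A.domRestrict G)
      (comap ((↑) : A → E) (volume.withDensity fun y => ENNReal.ofReal (J y)))
      = (μHE[finrank ℝ E]).restrict (G '' A) := by
    refine Measure.ext fun t ht => ?_
    rw [hemb.map_apply, comap_apply _ Subtype.val_injective
      (fun s hs => (MeasurableEmbedding.subtype_coe hA).measurableSet_image.2 hs) _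
      (hemb.measurable ht), Measure.restrict_apply ht]
    have himg : Subtype.val '' (A.domRestrict G ⁻¹' t) ⊆ A := by
      rintro _ ⟨y, -, rfl⟩
      exact y.2
    have hm := (MeasurableEmbedding.subtype_coe hA).measurableSet_image.2 (hemb.measurable ht)
    rw [withDensity_apply _ hm, ← euclideanHausdorffMeasure_image_eq_lintegral_normDet hD hG hGinj
      himm hm (himg.trans hAD)]
    congr 1
    ext z
    constructor
    · rintro ⟨_, ⟨y, hy, rfl⟩, rfl⟩
      exact ⟨hy, y, y.2, rfl⟩
    · rintro ⟨hz, y, hy, rfl⟩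
      exact ⟨y, ⟨⟨y, hy⟩, hz, rfl⟩, rfl⟩
  rw [← hmap, hemb.integral_map]
  simp only [Set.domRestrict_apply, ← Function.comp_apply (f := h), ENNReal.ofReal]
  rw [← (MeasurableEmbedding.subtype_coe hA).integral_map, map_comap_subtype_coe hA,
    setIntegral_withDensity_eq_setIntegral_smul₀ hJm _ hA]
  congr with y
  rw [NNReal.smul_def, Real.coe_toNNReal _ (LinearMap.normDet_nonneg _)]

theorem setIntegral_image_curve {V : Type*} [NormedAddCommGroup V]
    [NormedSpace ℝ V] {c : ℝ → F} {D A : Set ℝ}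
    (hD : IsOpen D) (hc : ContDiffOn ℝ 1 c D) (hcinj : InjOn c D)
    (himm : ∀ t ∈ D, deriv c t ≠ 0) (hA : MeasurableSet A) (hAD : A ⊆ D) (h : F → V) :
    ∫ x in c '' A, h x ∂μHE[1] = ∫ t in A, ‖deriv c t‖ • h (c t) := by
  have himm' : ∀ t ∈ D, Function.Injective (fderiv ℝ c t) := by
    intro t ht
    refine (injective_iff_map_eq_zero _).2 fun r hr => ?_
    have h1 : fderiv ℝ c t r = r • deriv c t := by
      rw [← fderiv_apply_one_eq_deriv, ← map_smul, smul_eq_mul, mul_one]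
    rw [h1] at hr
    exact (smul_eq_zero.1 hr).resolve_right (himm t ht)
  have := setIntegral_image_eq_setIntegral_normDet_smul hD hc hcinj himm' hA hAD h
  rw [finrank_self] at this
  rw [this]
  refine setIntegral_congr_fun hA fun t _ => ?_
  have h2 := (fderiv ℝ c t : ℝ →ₗ[ℝ] F).normDet_sq_eq_det_gram
    (OrthonormalBasis.singleton (Fin 1) ℝ)
  simp only [RCLike.ofReal_real_eq_id, id_eq, Matrix.det_unique, Matrix.gram_apply,
    OrthonormalBasis.singleton_apply, ContinuousLinearMap.coe_coe, fderiv_apply_one_eq_deriv,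
    real_inner_self_eq_norm_sq] at h2
  rw [(pow_left_inj₀ (LinearMap.normDet_nonneg _) (norm_nonneg _) two_ne_zero).1 h2]

/-- The area formula for a surface parametrized over the plane, where the Jacobian is the square
root of the Gram determinant. The plane `ℝ × ℝ` carries the supremum norm, so the proof passes to the
Euclidean plane `WithLp 2 (ℝ × ℝ)`, which has the same Lebesgue measure. -/
theorem setIntegral_image_surface {V : Type*} [NormedAddCommGroup V]
    [NormedSpace ℝ V] {G : ℝ × ℝ → F} {D A : Set (ℝ × ℝ)}
    (hD : IsOpen D) (hG : ContDiffOn ℝ 1 G D) (hGinj : InjOn G D)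
    (himm : ∀ y ∈ D, Function.Injective (fderiv ℝ G y)) (hA : MeasurableSet A) (hAD : A ⊆ D)
    (h : F → V) :
    ∫ x in G '' A, h x ∂μHE[2]
      = ∫ y in A, √(‖fderiv ℝ G y (1, 0)‖ ^ 2 * ‖fderiv ℝ G y (0, 1)‖ ^ 2
          - ⟪fderiv ℝ G y (1, 0), fderiv ℝ G y (0, 1)⟫ ^ 2) • h (G y) := by
  set T : WithLp 2 (ℝ × ℝ) ≃L[ℝ] ℝ × ℝ := WithLp.prodContinuousLinearEquiv 2 ℝ ℝ ℝ with hT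
  have hTm : MeasurePreserving T := WithLp.volume_preserving_ofLp ℝ ℝ
  have hTe : MeasurableEmbedding T := T.toHomeomorph.measurableEmbedding
  have hfd : ∀ z, fderiv ℝ (G ∘ T) z = (fderiv ℝ G (T z)).comp (T : WithLp 2 (ℝ × ℝ) →L[ℝ] ℝ × ℝ) :=
    fun z => T.comp_right_fderiv
  have himm' : ∀ z ∈ T ⁻¹' D, Function.Injective (fderiv ℝ (G ∘ T) z) := by
    intro z hz
    rw [hfd]
    exact (himm _ hz).comp T.injective
  have hmain := setIntegral_image_eq_setIntegral_normDet_smul (G := G ∘ T) (D := T ⁻¹' D)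
    (A := T ⁻¹' A) (hD.preimage T.continuous)
    (hG.comp T.contDiff.contDiffOn (mapsTo_preimage _ _))
    (fun y hy z hz hyz => T.injective (hGinj hy hz hyz)) himm' (T.continuous.measurable hA)
    (preimage_mono hAD) h
  have hfr : finrank ℝ (WithLp 2 (ℝ × ℝ)) = 2 := by
    rw [T.toLinearEquiv.finrank_eq, finrank_prod, finrank_self]
  rw [hfr, image_comp, image_preimage_eq _ T.surjective] at hmain
  rw [hmain, ← hTm.setIntegral_preimage_emb hTe]
  refine setIntegral_congr_fun (T.continuous.measurable hA) fun z _ => ?_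
  have h2 := (fderiv ℝ (G ∘ T) z : WithLp 2 (ℝ × ℝ) →ₗ[ℝ] F).normDet_sq_eq_det_gram
    (((OrthonormalBasis.singleton (Fin 1) ℝ).prod (OrthonormalBasis.singleton (Fin 1) ℝ)).reindex
      finSumFinEquiv)
  have hb0 : finSumFinEquiv.symm (0 : Fin (1 + 1)) = Sum.inl 0 := rfl
  have hb1 : finSumFinEquiv.symm (1 : Fin (1 + 1)) = Sum.inr 0 := rfl
  have hT0 : T (WithLp.toLp 2 (1, 0)) = (1, 0) := rfl
  have hT1 : T (WithLp.toLp 2 (0, 1)) = (0, 1) := rfl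
  have hdet : ∀ m : Matrix (Fin (1 + 1)) (Fin (1 + 1)) ℝ,
      m.det = m 0 0 * m 1 1 - m 0 1 * m 1 0 := Matrix.det_fin_two
  rw [hdet] at h2
  simp only [RCLike.ofReal_real_eq_id, id_eq, Matrix.gram_apply, OrthonormalBasis.reindex_apply,
    hb0, hb1, OrthonormalBasis.prod_apply, Sum.elim_inl, Sum.elim_inr, Function.comp_apply,
    OrthonormalBasis.singleton_apply, ContinuousLinearMap.coe_coe, hfd,
    ContinuousLinearMap.comp_apply, ContinuousLinearEquiv.coe_coe,
    LinearMap.coe_inl, LinearMap.coe_inr, hT0, hT1, real_inner_self_eq_norm_sq] at h2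
  rw [real_inner_comm (fderiv ℝ G (T z) (1, 0)), ← sq] at h2
  rw [← h2, Real.sqrt_sq (LinearMap.normDet_nonneg _), hfd]
  rfl

end AreaFormula

/-! ### Vector algebra in three dimensions -/

theorem inner_eq_sum (u v : E3) : ⟪u, v⟫ = u 0 * v 0 + u 1 * v 1 + u 2 * v 2 := by
  simp [PiLp.inner_apply, Fin.sum_univ_three, mul_comm]

theorem norm_sq_eq_sum (u : E3) : ‖u‖ ^ 2 = u 0 ^ 2 + u 1 ^ 2 + u 2 ^ 2 := by
  rw [← real_inner_self_eq_norm_sq, inner_eq_sum]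
  ring

theorem cross_apply (u v : E3) (k : Fin 3) :
    cross u v k = u (k + 1) * v (k + 2) - u (k + 2) * v (k + 1) := by
  fin_cases k <;> simp [cross, crossProduct]

theorem cross_coords (u v : E3) :
    cross u v 0 = u 1 * v 2 - u 2 * v 1 ∧ cross u v 1 = u 2 * v 0 - u 0 * v 2 ∧
      cross u v 2 = u 0 * v 1 - u 1 * v 0 :=
  ⟨cross_apply u v 0, cross_apply u v 1, cross_apply u v 2⟩

theorem e_apply (i j : Fin 3) : e i j = if j = i then 1 else 0 := by
  simp [e]

theorem ext_three {u v : E3} (h0 : u 0 = v 0) (h1 : u 1 = v 1) (h2 : u 2 = v 2) : u = v := by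
  ext i
  fin_cases i <;> assumption

theorem norm_cross_sq (u v : E3) : ‖cross u v‖ ^ 2 = ‖u‖ ^ 2 * ‖v‖ ^ 2 - ⟪u, v⟫ ^ 2 := by
  simp only [norm_sq_eq_sum, inner_eq_sum, cross_coords]
  ring

/-- The cross product as a continuous bilinear map. -/
noncomputable def crossL : E3 →L[ℝ] E3 →L[ℝ] E3 :=
  LinearMap.toContinuousLinearMap
    ((LinearMap.toContinuousLinearMap : (E3 →ₗ[ℝ] E3) ≃ₗ[ℝ] (E3 →L[ℝ] E3)).toLinearMap ∘ₗ
      LinearMap.mk₂ ℝ cross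
        (fun u u' v => by
          apply ext_three <;> simp only [cross_coords, PiLp.add_apply] <;> ring)
        (fun c u v => by
          apply ext_three <;>
            simp only [cross_coords, PiLp.smul_apply, smul_eq_mul] <;> ring)
        (fun u v v' => by
          apply ext_three <;> simp only [cross_coords, PiLp.add_apply] <;> ring)
        (fun c u v => by
          apply ext_three <;>
            simp only [cross_coords, PiLp.smul_apply, smul_eq_mul] <;> ring))

@[simp]
theorem crossL_apply (u v : E3) : crossL u v = cross u v := rfl

/-! ### Local graph representation of the level set -/

section Chart

open Topology Filter
open scoped NNReal

/-- Inside the open set `W` the zero level set of `φ` is the image of the open set `D` of the plane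
under `G`, and it is a graph: `G` is inverse to the projection along the `k`-th coordinate axis.
The plane carries the two remaining coordinates in cyclic order, numbered `k + 1` and `k + 2`
modulo three, so that the parametrization is oriented by `e k`. -/
structure GraphChart (φ : E3 → ℝ) (k : Fin 3) (W : Set E3) (D : Set (ℝ × ℝ)) (G : ℝ × ℝ → E3) :
    Prop where
  isOpen_set : IsOpen W
  isOpen_dom : IsOpen D
  isBounded_dom : Bornology.IsBounded D
  contDiffOn : ContDiffOn ℝ 2 G D
  lipschitz : ∃ K : ℝ≥0, LipschitzOnWith K G D
  mapsTo : MapsTo G D W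
  level_eq_zero : ∀ y ∈ D, φ (G y) = 0
  fst_coord : ∀ y ∈ D, G y (k + 1) = y.1
  snd_coord : ∀ y ∈ D, G y (k + 2) = y.2
  mem_dom : ∀ x ∈ W, φ x = 0 → (x (k + 1), x (k + 2)) ∈ D
  apply_coord : ∀ x ∈ W, φ x = 0 → G (x (k + 1), x (k + 2)) = x

/-- The implicit function theorem along the `k`-th coordinate axis. -/
theorem exists_graphChart {φ : E3 → ℝ} {k : Fin 3} {x₀ : E3} (hφ : ContDiffAt ℝ 2 φ x₀)
    (hx₀ : φ x₀ = 0) (hk : fderiv ℝ φ x₀ (e k) ≠ 0) {W₀ : Set E3} (hW₀ : W₀ ∈ 𝓝 x₀) :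
    ∃ W D G, GraphChart φ k W D G ∧ x₀ ∈ W ∧ W ⊆ W₀ := by
  let c : (ℝ × ℝ) × ℝ →L[ℝ] E3 :=
    ((ContinuousLinearMap.fst ℝ ℝ ℝ).comp (ContinuousLinearMap.fst ℝ (ℝ × ℝ) ℝ)).smulRight
        (e (k + 1))
      + ((ContinuousLinearMap.snd ℝ ℝ ℝ).comp (ContinuousLinearMap.fst ℝ (ℝ × ℝ) ℝ)).smulRight
        (e (k + 2))
      + (ContinuousLinearMap.snd ℝ (ℝ × ℝ) ℝ).smulRight (e k)
  have hc : ∀ v, c v = v.1.1 • e (k + 1) + v.1.2 • e (k + 2) + v.2 • e k := fun v => rfl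
  let p : E3 → (ℝ × ℝ) × ℝ := fun x => ((x (k + 1), x (k + 2)), x k)
  have hp : Continuous p := by fun_prop
  have hcp : ∀ x, c (p x) = x := by
    intro x
    rw [hc]
    apply ext_three <;> fin_cases k <;> simp [p, e_apply]
  have hpc : ∀ v, p (c v) = v := by
    intro v
    simp only [hc, p]
    refine Prod.ext (Prod.ext ?_ ?_) ?_ <;> fin_cases k <;> simp [e_apply]
  set u := p x₀ with hu
  have hcu : c u = x₀ := hcp x₀
  have hf : ContDiffAt ℝ 2 (φ ∘ c) u := by
    refine ContDiffAt.comp u ?_ c.contDiff.contDiffAt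
    rwa [hcu]
  have hfd : fderiv ℝ (φ ∘ c) u = (fderiv ℝ φ x₀).comp c := by
    rw [fderiv_comp _ (by rw [hcu]; exact hφ.differentiableAt two_ne_zero) c.differentiableAt, hcu,
      c.fderiv]
  have hinv : (fderiv ℝ (φ ∘ c) u ∘L .inr ℝ (ℝ × ℝ) ℝ).IsInvertible := by
    refine ⟨ContinuousLinearEquiv.unitsEquivAut ℝ (Units.mk0 _ hk), ?_⟩
    ext
    simp [hfd, hc]
  set ψ := hf.implicitFunction two_ne_zero hinv with hψ
  have hψu : ψ u.1 = u.2 := hf.implicitFunction_apply_self two_ne_zero hinv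
  have hψc : ContDiffAt ℝ 2 ψ u.1 :=
    hf.contDiffAt_implicitFunction two_ne_zero hinv
  let G : ℝ × ℝ → E3 := fun y => c (y, ψ y)
  have hGu : G u.1 = x₀ := by
    simp only [G, hψu]
    exact hcu
  have hGc : ∀ y, ContDiffAt ℝ 2 ψ y → ContDiffAt ℝ 2 G y := fun y hy =>
    c.contDiff.contDiffAt.comp y (contDiffAt_id.prodMk hy)
  have hiff : ∀ᶠ x in 𝓝 x₀, φ (c (p x)) = 0 ↔ ψ (p x).1 = (p x).2 := by
    have := hf.eventually_apply_eq_iff_implicitFunction two_ne_zero hinv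
    simp only [Function.comp_apply, hcu, hx₀] at this
    exact hp.continuousAt.eventually this
  obtain ⟨O, hO, hOo, hxO⟩ := mem_nhds_iff.1 (inter_mem hW₀ hiff)
  have hG1 : ∀ᶠ y in 𝓝 u.1, φ (G y) = 0 := by
    have := hf.eventually_apply_implicitFunction two_ne_zero hinv
    simpa only [Function.comp_apply, hcu, hx₀] using this
  have hG2 : ∀ᶠ y in 𝓝 u.1, ContDiffAt ℝ 2 ψ y := hψc.eventually (by simp)
  have hG3 : ∀ᶠ y in 𝓝 u.1, G y ∈ O :=
    (hGc _ hψc).continuousAt.eventually (by rw [hGu]; exact hOo.mem_nhds hxO)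
  obtain ⟨K, s, hs, hK⟩ := ((hGc _ hψc).of_le one_le_two).exists_lipschitzOnWith
  obtain ⟨D, hD, hDo, huD⟩ := mem_nhds_iff.1
    (inter_mem (inter_mem hs (Metric.ball_mem_nhds _ one_pos)) (hG1.and (hG2.and hG3)))
  have hpG : ∀ y, p (G y) = (y, ψ y) := fun y => hpc _
  refine ⟨O ∩ (fun x => (p x).1) ⁻¹' D, D, G, ?_, ⟨hxO, huD⟩,
    fun x hx => (hO hx.1).1⟩
  refine
    { isOpen_set := hOo.inter (hDo.preimage (continuous_fst.comp hp))
      isOpen_dom := hDo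
      isBounded_dom := Metric.isBounded_ball.subset fun y hy => (hD hy).1.2
      contDiffOn := fun y hy => (hGc y (hD hy).2.2.1).contDiffWithinAt
      lipschitz := ⟨K, hK.mono fun y hy => (hD hy).1.1⟩
      mapsTo := fun y hy => ⟨(hD hy).2.2.2, by
        change (p (G y)).1 ∈ D
        rwa [hpG]⟩
      level_eq_zero := fun y hy => (hD hy).2.1
      fst_coord := fun y _ => congrArg (fun v => v.1.1) (hpG y)
      snd_coord := fun y _ => congrArg (fun v => v.1.2) (hpG y)
      mem_dom := fun x hx _ => hx.2
      apply_coord := fun x hx hφx => ?_ }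
  have h1 := (hO hx.1).2
  simp only [mem_ofPred_eq, hcp] at h1
  have h2 := h1.1 hφx
  change c ((p x).1, ψ (p x).1) = x
  rw [h2]
  exact hcp x

end Chart

/-! ### Normal, conormal and tangent of the boundary curve -/

theorem inner_cross_cross (u v w z : E3) :
    ⟪cross u v, cross w z⟫ = ⟪u, w⟫ * ⟪v, z⟫ - ⟪u, z⟫ * ⟪v, w⟫ := by
  simp only [inner_eq_sum, cross_coords]
  ring

theorem cross_cross (u v w : E3) : cross u (cross v w) = ⟪u, w⟫ • v - ⟪u, v⟫ • w := by
  apply ext_three <;>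
    simp only [inner_eq_sum, cross_coords, PiLp.sub_apply, PiLp.smul_apply,
      smul_eq_mul] <;> ring

theorem inner_e (u : E3) (i : Fin 3) : ⟪u, e i⟫ = u i := by
  simp [e, EuclideanSpace.inner_single_right]

theorem dyad_apply (u v w : E3) : dyad u v w = ⟪v, w⟫ • u := rfl

theorem projector_apply (φ : E3 → ℝ) (x v : E3) :
    projector φ x v = v - ⟪unitNormal φ x, v⟫ • unitNormal φ x := by
  simp [projector, dyad_apply]

theorem norm_unitNormal {φ : E3 → ℝ} {x : E3} (hx : gradient φ x ≠ 0) : ‖unitNormal φ x‖ = 1 := by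
  rw [unitNormal, norm_smul, norm_inv, norm_norm, inv_mul_cancel₀ (norm_ne_zero_iff.2 hx)]

theorem inner_gradient_eq_fderiv (φ : E3 → ℝ) (x v : E3) : ⟪gradient φ x, v⟫ = fderiv ℝ φ x v := by
  rw [gradient, InnerProductSpace.toDual_symm_apply]

theorem inner_unitNormal_eq_zero {φ : E3 → ℝ} {x v : E3} (h : fderiv ℝ φ x v = 0) :
    ⟪unitNormal φ x, v⟫ = 0 := by
  rw [unitNormal, real_inner_smul_left, inner_gradient_eq_fderiv, h, mul_zero]

/-- If `τ` is tangent to the surface and orthogonal to the normal `ν` of a face, then the conormal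
`P ν / ‖P ν‖` turned by a right angle in the tangent plane is `τ / ‖τ‖`, up to the sign `κ` that
compares `n`, `ν`, `τ` with the standard orientation. -/
theorem norm_smul_cross_conormal {n ν τ : E3} {κ : ℝ} (hn : ‖n‖ = 1) (hnτ : ⟪n, τ⟫ = 0)
    (hντ : ⟪ν, τ⟫ = 0) (hκ : κ ^ 2 = 1) (hpos : 0 < κ * ⟪n, cross ν τ⟫) :
    ‖τ‖ • cross n (‖ν - ⟪n, ν⟫ • n‖⁻¹ • (ν - ⟪n, ν⟫ • n)) = κ • τ := by
  have hnn : ⟪n, n⟫ = 1 := by rw [real_inner_self_eq_norm_sq, hn, one_pow]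
  have hτ : τ ≠ 0 := by
    rintro rfl
    have : cross ν 0 = 0 := by
      apply ext_three <;> simp [cross_coords]
    simp [this] at hpos
  have hτ0 : 0 < ‖τ‖ := norm_pos_iff.2 hτ
  set r := cross n ν with hr
  have hcp : cross n (ν - ⟪n, ν⟫ • n) = r := by
    apply ext_three <;>
      simp only [hr, cross_coords, PiLp.sub_apply, PiLp.smul_apply,
        smul_eq_mul] <;> ring
  have hnorm : ‖ν - ⟪n, ν⟫ • n‖ = ‖r‖ := by
    have h1 := norm_cross_sq n (ν - ⟪n, ν⟫ • n)
    have h2 : ⟪n, ν - ⟪n, ν⟫ • n⟫ = 0 := by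
      rw [inner_sub_right, real_inner_smul_right, hnn, mul_one, sub_self]
    rw [hcp, h2, hn] at h1
    exact (pow_left_inj₀ (norm_nonneg _) (norm_nonneg _) two_ne_zero).1 (by linarith)
  have hrτ : ⟪τ, r⟫ = ⟪n, cross ν τ⟫ := by
    simp only [hr, inner_eq_sum, cross_coords]
    ring
  obtain ⟨ρ, hρ⟩ : ∃ ρ, r = ρ • τ := by
    refine ⟨(‖τ‖ ^ 2)⁻¹ * ⟪τ, r⟫, ?_⟩
    have h1 : cross τ r = 0 := by
      rw [hr, cross_cross, real_inner_comm, hντ, real_inner_comm, hnτ]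
      simp
    have h2 := cross_cross τ τ r
    rw [h1, real_inner_self_eq_norm_sq] at h2
    have h3 : cross τ 0 = 0 := by
      apply ext_three <;> simp [cross_coords]
    rw [h3, eq_comm, sub_eq_zero] at h2
    rw [mul_smul, h2, smul_smul, inv_mul_cancel₀ (by positivity), one_smul]
  have hκρ : 0 < κ * ρ := by
    rw [← hrτ, hρ, real_inner_smul_right, real_inner_self_eq_norm_sq, ← mul_assoc] at hpos
    exact pos_of_mul_pos_left hpos (by positivity)
  have hrn : ‖r‖ = κ * ρ * ‖τ‖ := by
    have habs : |κ| = 1 := by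
      rw [← sq_eq_sq₀ (abs_nonneg _) zero_le_one, sq_abs, hκ, one_pow]
    rw [hρ, norm_smul, Real.norm_eq_abs, ← abs_of_pos hκρ, abs_mul, habs, one_mul]
  have hlin : cross n (‖ν - ⟪n, ν⟫ • n‖⁻¹ • (ν - ⟪n, ν⟫ • n)) = ‖r‖⁻¹ • r := by
    rw [← crossL_apply, map_smul, crossL_apply, hcp, hnorm]
  rw [hlin, smul_smul, hrn, hρ, smul_smul]
  congr 1
  have hρ0 : ρ ≠ 0 := by rintro rfl; simp at hκρ
  have hκ0 : κ ≠ 0 := by rintro rfl; simp at hκρ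
  field_simp
  rw [hκ]

/-! ### The curl of a vector field -/

/-- The curl of a vector field. As the derivative of `A` is the tensor `∂_j A_i e^i ⊗ e^j`, the curl
`∂_j A_i e^j × e^i` is the opposite of its axial vector `[∇A]_×`. -/
noncomputable def curl (A : E3 → E3) (x : E3) : E3 := -crossVec (fderiv ℝ A x)

theorem crossVec_apply_zero (T : Tensor2) : crossVec T 0 = T (e 2) 1 - T (e 1) 2 := by
  simp [crossVec, Fin.sum_univ_three, cross_coords, e_apply]
  ring

theorem crossVec_apply_one (T : Tensor2) : crossVec T 1 = T (e 0) 2 - T (e 2) 0 := by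
  simp [crossVec, Fin.sum_univ_three, cross_coords, e_apply]
  ring

theorem crossVec_apply_two (T : Tensor2) : crossVec T 2 = T (e 1) 0 - T (e 0) 1 := by
  simp [crossVec, Fin.sum_univ_three, cross_coords, e_apply]
  ring

theorem eq_sum_smul_e (u : E3) : u = u 0 • e 0 + u 1 • e 1 + u 2 • e 2 := by
  apply ext_three <;> simp [e_apply]

/-- The antisymmetric part of the derivative of `A` is the flux form of `curl A`. -/
theorem inner_curl_cross (A : E3 → E3) (x u v : E3) :
    ⟪curl A x, cross u v⟫ = ⟪fderiv ℝ A x u, v⟫ - ⟪fderiv ℝ A x v, u⟫ := by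
  set T := fderiv ℝ A x with hT
  have hu : T u = u 0 • T (e 0) + u 1 • T (e 1) + u 2 • T (e 2) := by
    conv_lhs => rw [eq_sum_smul_e u]
    simp
  have hv : T v = v 0 • T (e 0) + v 1 • T (e 1) + v 2 • T (e 2) := by
    conv_lhs => rw [eq_sum_smul_e v]
    simp
  rw [hu, hv, curl, ← hT]
  simp only [inner_eq_sum, cross_coords, PiLp.neg_apply, crossVec_apply_zero,
    crossVec_apply_one, crossVec_apply_two, PiLp.add_apply, PiLp.smul_apply, smul_eq_mul]
  ring

/-! ### Tangent vectors and normal in a chart -/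

namespace GraphChart

variable {φ : E3 → ℝ} {k : Fin 3} {W : Set E3} {D : Set (ℝ × ℝ)} {G : ℝ × ℝ → E3}

theorem contDiffAt (h : GraphChart φ k W D G) {y : ℝ × ℝ} (hy : y ∈ D) : ContDiffAt ℝ 2 G y :=
  h.contDiffOn.contDiffAt (h.isOpen_dom.mem_nhds hy)

theorem differentiableAt (h : GraphChart φ k W D G) {y : ℝ × ℝ} (hy : y ∈ D) :
    DifferentiableAt ℝ G y := (h.contDiffAt hy).differentiableAt two_ne_zero

theorem fderiv_fst (h : GraphChart φ k W D G) {y : ℝ × ℝ} (hy : y ∈ D) (v : ℝ × ℝ) :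
    fderiv ℝ G y v (k + 1) = v.1 := by
  have h1 : HasFDerivAt (fun z => G z (k + 1))
      ((EuclideanSpace.proj (k + 1) : E3 →L[ℝ] ℝ).comp (fderiv ℝ G y)) y :=
    (EuclideanSpace.proj (k + 1) : E3 →L[ℝ] ℝ).hasFDerivAt.comp y
      (h.differentiableAt hy).hasFDerivAt
  have h2 : HasFDerivAt (fun z => G z (k + 1)) (ContinuousLinearMap.fst ℝ ℝ ℝ) y :=
    hasFDerivAt_fst.congr_of_eventuallyEq
      ((h.isOpen_dom.eventually_mem hy).mono fun z hz => h.fst_coord z hz)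
  exact congrArg (fun L : ℝ × ℝ →L[ℝ] ℝ => L v) (h1.unique h2)

theorem fderiv_snd (h : GraphChart φ k W D G) {y : ℝ × ℝ} (hy : y ∈ D) (v : ℝ × ℝ) :
    fderiv ℝ G y v (k + 2) = v.2 := by
  have h1 : HasFDerivAt (fun z => G z (k + 2))
      ((EuclideanSpace.proj (k + 2) : E3 →L[ℝ] ℝ).comp (fderiv ℝ G y)) y :=
    (EuclideanSpace.proj (k + 2) : E3 →L[ℝ] ℝ).hasFDerivAt.comp y
      (h.differentiableAt hy).hasFDerivAt
  have h2 : HasFDerivAt (fun z => G z (k + 2)) (ContinuousLinearMap.snd ℝ ℝ ℝ) y :=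
    hasFDerivAt_snd.congr_of_eventuallyEq
      ((h.isOpen_dom.eventually_mem hy).mono fun z hz => h.snd_coord z hz)
  exact congrArg (fun L : ℝ × ℝ →L[ℝ] ℝ => L v) (h1.unique h2)

theorem fderiv_injective (h : GraphChart φ k W D G) {y : ℝ × ℝ} (hy : y ∈ D) :
    Function.Injective (fderiv ℝ G y) := by
  intro v w hvw
  refine Prod.ext ?_ ?_
  · rw [← h.fderiv_fst hy v, hvw, h.fderiv_fst hy]
  · rw [← h.fderiv_snd hy v, hvw, h.fderiv_snd hy]

theorem injOn (h : GraphChart φ k W D G) : InjOn G D := by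
  intro y hy z hz hyz
  refine Prod.ext ?_ ?_
  · rw [← h.fst_coord y hy, hyz, h.fst_coord z hz]
  · rw [← h.snd_coord y hy, hyz, h.snd_coord z hz]

theorem inner_unitNormal_fderiv (h : GraphChart φ k W D G) {y : ℝ × ℝ} (hy : y ∈ D)
    (hφ : DifferentiableAt ℝ φ (G y)) (v : ℝ × ℝ) : ⟪unitNormal φ (G y), fderiv ℝ G y v⟫ = 0 := by
  apply inner_unitNormal_eq_zero
  have h1 := hφ.hasFDerivAt.comp y (h.differentiableAt hy).hasFDerivAt
  have h2 : HasFDerivAt (φ ∘ G) (0 : ℝ × ℝ →L[ℝ] ℝ) y :=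
    (hasFDerivAt_const (0 : ℝ) y).congr_of_eventuallyEq
      ((h.isOpen_dom.eventually_mem hy).mono fun z hz => h.level_eq_zero z hz)
  exact congrArg (fun L : ℝ × ℝ →L[ℝ] ℝ => L v) (h1.unique h2)

/-- The unit normal is the `k`-th component of the unit normal times the normal of the
parametrization. -/
theorem unitNormal_eq (h : GraphChart φ k W D G) {y : ℝ × ℝ} (hy : y ∈ D)
    (hφ : DifferentiableAt ℝ φ (G y)) :
    unitNormal φ (G y)
      = unitNormal φ (G y) k • cross (fderiv ℝ G y (1, 0)) (fderiv ℝ G y (0, 1)) := by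
  have o1 := h.inner_unitNormal_fderiv hy hφ (1, 0)
  have o2 := h.inner_unitNormal_fderiv hy hφ (0, 1)
  have f1 := h.fderiv_fst hy (1, 0)
  have f2 := h.fderiv_fst hy (0, 1)
  have s1 := h.fderiv_snd hy (1, 0)
  have s2 := h.fderiv_snd hy (0, 1)
  set n := unitNormal φ (G y)
  set u := fderiv ℝ G y (1, 0)
  set v := fderiv ℝ G y (0, 1)
  rw [inner_eq_sum] at o1 o2
  apply ext_three <;> fin_cases k <;>
    simp [PiLp.smul_apply, cross_coords] at f1 f2 s1 s2 ⊢ <;>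
    simp only [f1, f2, s1, s2] at o1 o2 ⊢ <;> linarith

end GraphChart

/-! ### Stokes' theorem in a chart -/

section LocalStokes

open Topology Filter
open scoped NNReal

theorem cuboid_eq_preimage (a b : E3) :
    cuboid a b = EuclideanSpace.equiv (Fin 3) ℝ ⁻¹' (univ.pi fun i => Icc (a i) (b i)) := by
  ext y
  simp only [cuboid, mem_preimage, mem_univ_pi, mem_Icc]
  rfl

theorem isCompact_cuboid (a b : E3) : IsCompact (cuboid a b) := by
  rw [cuboid_eq_preimage]
  exact (EuclideanSpace.equiv (Fin 3) ℝ).toHomeomorph.isCompact_preimage.2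
    (isCompact_univ_pi fun i => isCompact_Icc)

theorem isClosed_cuboid (a b : E3) : IsClosed (cuboid a b) := (isCompact_cuboid a b).isClosed

theorem isClosed_midSurface {φ : E3 → ℝ} (hφ : Continuous φ) (a b : E3) :
    IsClosed (midSurface φ a b) :=
  (isClosed_cuboid a b).inter (isClosed_singleton.preimage hφ : IsClosed (φ ⁻¹' {0}))

theorem fin_three_cases (k l : Fin 3) : l = k ∨ l = k + 1 ∨ l = k + 2 := by
  revert k l
  decide

/-- The point evaluation at `w` of the pull-back of the one-form `⟪A, ·⟫` by `G`, extended by zero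
outside the domain `D` of the parametrization. -/
noncomputable def pullback (A : E3 → E3) (D : Set (ℝ × ℝ)) (G : ℝ × ℝ → E3) (w : ℝ × ℝ) :
    ℝ × ℝ → ℝ :=
  D.indicator fun y => ⟪A (G y), fderiv ℝ G y w⟫

namespace GraphChart

variable {φ : E3 → ℝ} {k : Fin 3} {W : Set E3} {D : Set (ℝ × ℝ)} {G : ℝ × ℝ → E3}
  {U : Set E3} {A : E3 → E3} {K : Set E3}

theorem contDiffAt_comp (h : GraphChart φ k W D G) (hU : IsOpen U) (hWU : W ⊆ U)
    (hA : ContDiffOn ℝ 1 A U) {y : ℝ × ℝ} (hy : y ∈ D) : ContDiffAt ℝ 1 (fun z => A (G z)) y :=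
  (hA.contDiffAt (hU.mem_nhds (hWU (h.mapsTo hy)))).comp y ((h.contDiffAt hy).of_le one_le_two)

theorem contDiffAt_fderiv (h : GraphChart φ k W D G) {y : ℝ × ℝ} (hy : y ∈ D) (w : ℝ × ℝ) :
    ContDiffAt ℝ 1 (fun z => fderiv ℝ G z w) y :=
  ((h.contDiffAt hy).fderiv_right (m := 1) (by norm_num)).clm_apply contDiffAt_const

theorem pullback_eventuallyEq (h : GraphChart φ k W D G) {y : ℝ × ℝ} (hy : y ∈ D) (w : ℝ × ℝ) :
    pullback A D G w =ᶠ[𝓝 y] fun z => ⟪A (G z), fderiv ℝ G z w⟫ :=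
  (h.isOpen_dom.eventually_mem hy).mono fun _ hz => indicator_of_mem hz _

/-- The support of the pull-back lies in the compact projection of `K ∩ {φ = 0}`, which is
contained in `D`; so the extension by zero is locally zero outside `D`. -/
theorem pullback_eventuallyEq_zero (h : GraphChart φ k W D G) (hφ : Continuous φ)
    (hK : IsCompact K) (hKW : K ⊆ W) (hAK : ∀ x ∉ K, A x = 0) (w : ℝ × ℝ) {y : ℝ × ℝ}
    (hy : y ∉ D) : pullback A D G w =ᶠ[𝓝 y] fun _ => 0 := by
  set C : Set (ℝ × ℝ) := (fun x : E3 => (x (k + 1), x (k + 2))) '' (K ∩ φ ⁻¹' {0}) with hC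
  have hCc : IsClosed C :=
    ((hK.inter_right (isClosed_singleton.preimage hφ)).image (by fun_prop)).isClosed
  have hyC : y ∉ C := by
    rintro ⟨x, hx, rfl⟩
    exact hy (h.mem_dom x (hKW hx.1) hx.2)
  filter_upwards [hCc.isOpen_compl.mem_nhds hyC] with z hz
  by_cases hzD : z ∈ D
  · rw [pullback, indicator_of_mem hzD, hAK, inner_zero_left]
    intro hzK
    refine hz ⟨G z, ⟨hzK, h.level_eq_zero z hzD⟩, ?_⟩
    simp only [h.fst_coord z hzD, h.snd_coord z hzD]
  · exact indicator_of_notMem hzD _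

theorem contDiff_pullback (h : GraphChart φ k W D G) (hφ : Continuous φ) (hU : IsOpen U)
    (hWU : W ⊆ U) (hA : ContDiffOn ℝ 1 A U) (hK : IsCompact K) (hKW : K ⊆ W)
    (hAK : ∀ x ∉ K, A x = 0) (w : ℝ × ℝ) : ContDiff ℝ 1 (pullback A D G w) := by
  rw [contDiff_iff_contDiffAt]
  intro y
  by_cases hy : y ∈ D
  · exact ((h.contDiffAt_comp hU hWU hA hy).inner ℝ
      (h.contDiffAt_fderiv hy w)).congr_of_eventuallyEq (h.pullback_eventuallyEq hy w)
  · exact contDiffAt_const.congr_of_eventuallyEq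
      (h.pullback_eventuallyEq_zero hφ hK hKW hAK w hy)

theorem fderiv_pullback_sub (h : GraphChart φ k W D G) (hU : IsOpen U)
    (hWU : W ⊆ U) (hA : ContDiffOn ℝ 1 A U) {y : ℝ × ℝ} (hy : y ∈ D) :
    fderiv ℝ (pullback A D G (0, 1)) y (1, 0) - fderiv ℝ (pullback A D G (1, 0)) y (0, 1)
      = ⟪curl A (G y), cross (fderiv ℝ G y (1, 0)) (fderiv ℝ G y (0, 1))⟫ := by
  have hAd : DifferentiableAt ℝ A (G y) :=
    (hA.contDiffAt (hU.mem_nhds (hWU (h.mapsTo hy)))).differentiableAt one_ne_zero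
  have key : ∀ v w : ℝ × ℝ, fderiv ℝ (pullback A D G w) y v
      = ⟪A (G y), fderiv ℝ (fderiv ℝ G) y v w⟫
        + ⟪fderiv ℝ A (G y) (fderiv ℝ G y v), fderiv ℝ G y w⟫ := by
    intro v w
    rw [(h.pullback_eventuallyEq hy w).fderiv_eq, fderiv_inner_apply ℝ
      ((h.contDiffAt_comp hU hWU hA hy).differentiableAt one_ne_zero)
      ((h.contDiffAt_fderiv hy w).differentiableAt one_ne_zero)]
    congr 2
    · rw [fderiv_clm_apply
        (((h.contDiffAt hy).fderiv_right (m := 1) (by norm_num)).differentiableAt one_ne_zero)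
        (differentiableAt_const _)]
      simp
    · change fderiv ℝ (A ∘ G) y v = _
      rw [fderiv_comp y hAd (h.differentiableAt hy)]
      rfl
  have hsymm : fderiv ℝ (fderiv ℝ G) y (1, 0) (0, 1) = fderiv ℝ (fderiv ℝ G) y (0, 1) (1, 0) :=
    ((h.contDiffAt hy).isSymmSndFDerivAt (by simp)).eq _ _
  rw [key, key, hsymm, inner_curl_cross]
  ring

theorem midSurface_inter (h : GraphChart φ k W D G) {a b : E3}
    (hWk : ∀ x ∈ W, a k < x k ∧ x k < b k) :
    midSurface φ a b ∩ W
      = G '' (D ∩ Icc (a (k + 1), a (k + 2)) (b (k + 1), b (k + 2))) := by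
  ext x
  constructor
  · rintro ⟨⟨hxc, hx0⟩, hxW⟩
    exact ⟨_, ⟨h.mem_dom x hxW hx0, ⟨(hxc _).1, (hxc _).1⟩, ⟨(hxc _).2, (hxc _).2⟩⟩,
      h.apply_coord x hxW hx0⟩
  · rintro ⟨y, ⟨hyD, hy1, hy2⟩, rfl⟩
    refine ⟨⟨fun l => ?_, h.level_eq_zero y hyD⟩, h.mapsTo hyD⟩
    rcases fin_three_cases k l with rfl | rfl | rfl
    · exact ⟨(hWk _ (h.mapsTo hyD)).1.le, (hWk _ (h.mapsTo hyD)).2.le⟩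
    · rw [h.fst_coord y hyD]
      exact ⟨hy1.1, hy2.1⟩
    · rw [h.snd_coord y hyD]
      exact ⟨hy1.2, hy2.2⟩

theorem curl_eq_zero (hK : IsCompact K) (hAK : ∀ x ∉ K, A x = 0) {x : E3} (hx : x ∉ K) :
    curl A x = 0 := by
  have : A =ᶠ[𝓝 x] fun _ => 0 :=
    (hK.isClosed.isOpen_compl.eventually_mem hx).mono fun z hz => hAK z hz
  rw [curl, this.fderiv_eq]
  simp [crossVec]

/-- The flux of the curl through the surface, computed in the chart. -/
theorem setIntegral_inner_curl (h : GraphChart φ k W D G) (hφ : Continuous φ) (hU : IsOpen U)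
    (hWU : W ⊆ U) (hφ2 : ContDiffOn ℝ 2 φ U) (hgrad : ∀ x ∈ U, gradient φ x ≠ 0)
    (hA : ContDiffOn ℝ 1 A U) (hK : IsCompact K) (hKW : K ⊆ W)
    (hAK : ∀ x ∉ K, A x = 0) {a b : E3} (hWk : ∀ x ∈ W, a k < x k ∧ x k < b k)
    {s : ℝ} (hs : s ^ 2 = 1) (hsn : ∀ x ∈ W, 0 < s * unitNormal φ x k) :
    ∫ x in midSurface φ a b, ⟪curl A x, unitNormal φ x⟫ ∂μHE[2]
      = s * ∫ y in Icc (a (k + 1), a (k + 2)) (b (k + 1), b (k + 2)),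
          (fderiv ℝ (pullback A D G (0, 1)) y (1, 0)
            - fderiv ℝ (pullback A D G (1, 0)) y (0, 1)) := by
  set R := Icc (a (k + 1), a (k + 2)) (b (k + 1), b (k + 2)) with hR
  have hDm := h.isOpen_dom.measurableSet
  have e1 : ∫ x in midSurface φ a b, ⟪curl A x, unitNormal φ x⟫ ∂μHE[2]
      = ∫ x in midSurface φ a b ∩ W, ⟪curl A x, unitNormal φ x⟫ ∂μHE[2] := by
    refine (setIntegral_eq_of_subset_of_forall_sdiff_eq_zero
      (isClosed_midSurface hφ a b).measurableSet inter_subset_left fun x hx => ?_)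
    have hxK : x ∉ K := fun hxK => hx.2 ⟨hx.1, hKW hxK⟩
    rw [curl_eq_zero hK hAK hxK, inner_zero_left]
  have e2 : ∫ y in R, (fderiv ℝ (pullback A D G (0, 1)) y (1, 0)
        - fderiv ℝ (pullback A D G (1, 0)) y (0, 1))
      = ∫ y in D ∩ R, (fderiv ℝ (pullback A D G (0, 1)) y (1, 0)
        - fderiv ℝ (pullback A D G (1, 0)) y (0, 1)) := by
    refine (setIntegral_eq_of_subset_of_forall_sdiff_eq_zero measurableSet_Icc
      inter_subset_right fun y hy => ?_)
    have hyD : y ∉ D := fun hyD => hy.2 ⟨hyD, hy.1⟩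
    simp [(h.pullback_eventuallyEq_zero hφ hK hKW hAK _ hyD).fderiv_eq]
  rw [e1, e2, h.midSurface_inter hWk, setIntegral_image_surface h.isOpen_dom
    (h.contDiffOn.of_le one_le_two) h.injOn (fun y hy => h.fderiv_injective hy)
    (hDm.inter measurableSet_Icc) inter_subset_left, ← integral_const_mul]
  refine setIntegral_congr_fun (hDm.inter measurableSet_Icc) fun y hy => ?_
  have hyU := hWU (h.mapsTo hy.1)
  have hφd : DifferentiableAt ℝ φ (G y) :=
    (hφ2.contDiffAt (hU.mem_nhds hyU)).differentiableAt two_ne_zero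
  rw [h.fderiv_pullback_sub hU hWU hA hy.1, ← norm_cross_sq, Real.sqrt_sq (norm_nonneg _)]
  have hn := h.unitNormal_eq hy.1 hφd
  have hn1 := norm_unitNormal (hgrad _ hyU)
  have hpos := hsn _ (h.mapsTo hy.1)
  set l := unitNormal φ (G y) k
  set N := cross (fderiv ℝ G y (1, 0)) (fderiv ℝ G y (0, 1))
  rw [hn, norm_smul, Real.norm_eq_abs] at hn1
  have habs : |l| = s * l := by
    have : |s| = 1 := by
      rw [← sq_eq_sq₀ (abs_nonneg _) zero_le_one, sq_abs, hs, one_pow]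
    rw [← abs_of_pos hpos, abs_mul, this, one_mul]
  rw [habs] at hn1
  rw [hn, real_inner_smul_right, smul_eq_mul, ← mul_assoc]
  congr 1
  have : s * (‖N‖ * l) = s * s := by
    rw [← sq, hs, ← hn1]; ring
  have hs0 : s ≠ 0 := by rintro rfl; simp at hs
  exact mul_left_cancel₀ hs0 this

end GraphChart

/-- The integrand of the circulation of `A` along the boundary curve: the component of `A` along
the positive unit tangent `n × μ`. -/
noncomputable def circulationDensity (φ : E3 → ℝ) (a b : E3) (A : E3 → E3) (x : E3) : ℝ :=
  ⟪A x, cross (unitNormal φ x) (conormal φ a b x)⟫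

theorem cuboidNormal_eq_of_face {a b x : E3} (hab : ∀ i, a i < b i) {l : Fin 3} {ε : ℝ}
    (hx : ∀ i ≠ l, a i < x i ∧ x i < b i)
    (hε : (x l = a l ∧ ε = -1) ∨ (x l = b l ∧ ε = 1)) : cuboidNormal a b x = ε • e l := by
  rw [cuboidNormal, Finset.sum_eq_single l]
  · rcases hε with ⟨h1, rfl⟩ | ⟨h1, rfl⟩
    · rw [if_neg (by rw [h1]; exact (hab l).ne), if_pos h1]
    · rw [if_pos h1]
  · intro i _ hi
    rw [if_neg (hx i hi).2.ne, if_neg (hx i hi).1.ne', zero_smul]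
  · simp

/-- The part in `W` of the surface that lies in the coordinate plane `x l = β`. -/
def edge (φ : E3 → ℝ) (a b : E3) (W : Set E3) (l : Fin 3) (β : ℝ) : Set E3 :=
  midSurface φ a b ∩ W ∩ {x | x l = β}

namespace GraphChart

variable {φ : E3 → ℝ} {k : Fin 3} {W : Set E3} {D : Set (ℝ × ℝ)} {G : ℝ × ℝ → E3}
  {U : Set E3} {A : E3 → E3} {K : Set E3}

/-- A piece of the boundary curve is the image of a segment of the rectangle that bounds the
parameter domain. -/
theorem edge_eq_image (h : GraphChart φ k W D G) {a b : E3}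
    (hWk : ∀ x ∈ W, a k < x k ∧ x k < b k) {l m : Fin 3} {γ : ℝ → ℝ × ℝ} {β : ℝ}
    (hlm : ∀ i, i = k ∨ i = l ∨ i = m) (hβ : a l ≤ β ∧ β ≤ b l)
    (hγl : ∀ t, γ t ∈ D → G (γ t) l = β) (hγm : ∀ t, γ t ∈ D → G (γ t) m = t)
    (hγx : ∀ x : E3, x l = β → γ (x m) = (x (k + 1), x (k + 2))) :
    edge φ a b W l β = (fun t => G (γ t)) '' (γ ⁻¹' D ∩ Icc (a m) (b m)) := by
  ext x
  constructor
  · rintro ⟨⟨⟨hxc, hx0⟩, hxW⟩, hxl⟩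
    have h1 := hγx x hxl
    refine ⟨x m, ⟨?_, hxc m⟩, ?_⟩
    · rw [mem_preimage, h1]
      exact h.mem_dom x hxW hx0
    · beta_reduce
      rw [h1]
      exact h.apply_coord x hxW hx0
  · rintro ⟨t, ⟨htD, ht⟩, rfl⟩
    refine ⟨⟨⟨fun i => ?_, h.level_eq_zero _ htD⟩, h.mapsTo htD⟩, hγl t htD⟩
    rcases hlm i with rfl | rfl | rfl
    · exact ⟨(hWk _ (h.mapsTo htD)).1.le, (hWk _ (h.mapsTo htD)).2.le⟩
    · rw [hγl t htD]
      exact hβ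
    · rw [hγm t htD]
      exact ht

/-- The circulation along one piece of the boundary curve, computed in the chart. The sign `κ`
tells whether the piece is traversed in the positive direction. -/
theorem setIntegral_edge (h : GraphChart φ k W D G) (hU : IsOpen U)
    (hWU : W ⊆ U) (hφ2 : ContDiffOn ℝ 2 φ U) (hgrad : ∀ x ∈ U, gradient φ x ≠ 0)
    {a b : E3} (hab : ∀ i, a i < b i) (hWk : ∀ x ∈ W, a k < x k ∧ x k < b k)
    {l m : Fin 3} {γ : ℝ → ℝ × ℝ} {w : ℝ × ℝ} {β ε κ : ℝ}
    (hlm : ∀ i, i = k ∨ i = l ∨ i = m) (hε : (β = a l ∧ ε = -1) ∨ (β = b l ∧ ε = 1))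
    (hγ : ContDiff ℝ 1 γ) (hγw : ∀ t, HasDerivAt γ w t) (hw : w ≠ 0)
    (hγl : ∀ t, γ t ∈ D → G (γ t) l = β) (hγm : ∀ t, γ t ∈ D → G (γ t) m = t)
    (hγx : ∀ x : E3, x l = β → γ (x m) = (x (k + 1), x (k + 2)))
    (hwl : ∀ y ∈ D, fderiv ℝ G y w l = 0) (hκ : κ ^ 2 = 1)
    (hpos : ∀ y ∈ D, 0 < κ * ⟪unitNormal φ (G y), cross (ε • e l) (fderiv ℝ G y w)⟫) :
    ∫ x in edge φ a b W l β, circulationDensity φ a b A x ∂μHE[1]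
      = κ * ∫ t in a m..b m, pullback A D G w (γ t) := by
  have hβ : a l ≤ β ∧ β ≤ b l := by
    rcases hε with ⟨rfl, -⟩ | ⟨rfl, -⟩
    · exact ⟨le_rfl, (hab l).le⟩
    · exact ⟨(hab l).le, le_rfl⟩
  have hTo : IsOpen (γ ⁻¹' D) := h.isOpen_dom.preimage hγ.continuous
  have hcC : ContDiffOn ℝ 1 (fun t => G (γ t)) (γ ⁻¹' D) :=
    (h.contDiffOn.of_le one_le_two).comp hγ.contDiffOn (mapsTo_preimage _ _)
  have hcder : ∀ t ∈ γ ⁻¹' D, deriv (fun t => G (γ t)) t = fderiv ℝ G (γ t) w := fun t ht =>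
    ((h.differentiableAt ht).hasFDerivAt.comp_hasDerivAt t (hγw t)).deriv
  have hcinj : InjOn (fun t => G (γ t)) (γ ⁻¹' D) := by
    intro t ht t' ht' htt
    rw [← hγm t ht, ← hγm t' ht']
    exact congrArg (fun x : E3 => x m) htt
  have hc0 : ∀ t ∈ γ ⁻¹' D, deriv (fun t => G (γ t)) t ≠ 0 := by
    intro t ht h0
    rw [hcder t ht, ← map_zero (fderiv ℝ G (γ t))] at h0
    exact hw (h.fderiv_injective ht h0)
  rw [h.edge_eq_image hWk hlm hβ hγl hγm hγx, setIntegral_image_curve hTo hcC hcinj hc0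
    (hTo.measurableSet.inter measurableSet_Icc) inter_subset_left,
    intervalIntegral.integral_of_le (hab m).le, ← integral_Icc_eq_integral_Ioc,
    ← integral_const_mul]
  have e1 : ∫ t in Icc (a m) (b m), κ * pullback A D G w (γ t)
      = ∫ t in γ ⁻¹' D ∩ Icc (a m) (b m), κ * pullback A D G w (γ t) := by
    refine setIntegral_eq_of_subset_of_forall_sdiff_eq_zero measurableSet_Icc
      inter_subset_right fun t ht => ?_
    have : γ t ∉ D := fun htD => ht.2 ⟨htD, ht.1⟩
    rw [pullback, indicator_of_notMem this, mul_zero]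
  rw [e1]
  -- the end points of the segment, where the curve may have a corner, do not matter
  refine setIntegral_congr_ae (hTo.measurableSet.inter measurableSet_Icc) ?_
  filter_upwards [compl_mem_ae_iff.2 (measure_singleton (μ := volume) (a m)),
    compl_mem_ae_iff.2 (measure_singleton (μ := volume) (b m))] with t hta htb ht
  obtain ⟨htD, htI⟩ := ht
  have hx : ∀ i ≠ l, a i < G (γ t) i ∧ G (γ t) i < b i := by
    intro i hi
    rcases hlm i with rfl | rfl | rfl
    · exact hWk _ (h.mapsTo htD)
    · exact absurd rfl hi
    · rw [hγm t htD]
      exact ⟨lt_of_le_of_ne htI.1 (Ne.symm hta), lt_of_le_of_ne htI.2 htb⟩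
  have hν := cuboidNormal_eq_of_face hab hx (ε := ε) (by rwa [hγl t htD])
  have hyU := hWU (h.mapsTo htD)
  have hφd : DifferentiableAt ℝ φ (G (γ t)) :=
    (hφ2.contDiffAt (hU.mem_nhds hyU)).differentiableAt two_ne_zero
  have hντ : ⟪ε • e l, fderiv ℝ G (γ t) w⟫ = 0 := by
    rw [real_inner_smul_left, real_inner_comm, inner_e, hwl _ htD, mul_zero]
  have key := norm_smul_cross_conormal (norm_unitNormal (hgrad _ hyU))
    (h.inner_unitNormal_fderiv htD hφd w) hντ hκ (hpos _ htD)
  rw [hcder t htD, circulationDensity, pullback, indicator_of_mem (show γ t ∈ D from htD),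
    conormal, hν, projector_apply, smul_eq_mul, ← real_inner_smul_right, key, real_inner_smul_right]

end GraphChart

theorem euclideanHausdorffMeasure_one_singleton (x : E3) : μHE[1] ({x} : Set E3) = 0 := by
  have := Measure.nullSingletonClass_hausdorff E3 (d := 1) one_pos
  rw [Measure.euclideanHausdorffMeasure_def, Measure.smul_apply]
  simp

theorem mem_frontier_cuboid {a b x : E3} (hx : x ∈ cuboid a b) :
    x ∈ frontier (cuboid a b) ↔ ∃ i, x i = a i ∨ x i = b i := by
  have hint : interior (cuboid a b) = {x : E3 | ∀ i, a i < x i ∧ x i < b i} := by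
    rw [cuboid_eq_preimage]
    have h2 := (EuclideanSpace.equiv (Fin 3) ℝ).toHomeomorph.preimage_interior
      (univ.pi fun i => Icc (a i) (b i))
    rw [ContinuousLinearEquiv.coe_toHomeomorph] at h2
    rw [← h2, interior_pi_set finite_univ]
    ext y
    simp
  rw [(isClosed_cuboid a b).frontier_eq, hint]
  constructor
  · rintro ⟨-, h⟩
    by_contra! hcon
    exact h fun i => ⟨lt_of_le_of_ne (hx i).1 (hcon i).1.symm, lt_of_le_of_ne (hx i).2 (hcon i).2⟩
  · rintro ⟨i, hi⟩
    refine ⟨hx, fun h => ?_⟩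
    rcases hi with hi | hi
    · exact (h i).1.ne' hi
    · exact (h i).2.ne hi

/-- In a set that avoids the two faces normal to the `k`-th coordinate axis, the boundary curve
consists of four edges. -/
theorem boundaryCurve_inter {φ : E3 → ℝ} {k : Fin 3} {W : Set E3} {a b : E3}
    (hWk : ∀ x ∈ W, a k < x k ∧ x k < b k) :
    boundaryCurve φ a b ∩ W
      = (edge φ a b W (k + 1) (b (k + 1)) ∪ edge φ a b W (k + 1) (a (k + 1))) ∪
        (edge φ a b W (k + 2) (b (k + 2)) ∪ edge φ a b W (k + 2) (a (k + 2))) := by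
  ext x
  constructor
  · rintro ⟨⟨hx, hxf⟩, hxW⟩
    obtain ⟨i, hi⟩ := (mem_frontier_cuboid hx.1).1 hxf
    rcases fin_three_cases k i with rfl | rfl | rfl
    · rcases hi with hi | hi
      · exact absurd hi (hWk x hxW).1.ne'
      · exact absurd hi (hWk x hxW).2.ne
    · rcases hi with hi | hi
      · exact Or.inl (Or.inr ⟨⟨hx, hxW⟩, hi⟩)
      · exact Or.inl (Or.inl ⟨⟨hx, hxW⟩, hi⟩)
    · rcases hi with hi | hi
      · exact Or.inr (Or.inr ⟨⟨hx, hxW⟩, hi⟩)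
      · exact Or.inr (Or.inl ⟨⟨hx, hxW⟩, hi⟩)
  · rintro ((⟨⟨hx, hxW⟩, hi⟩ | ⟨⟨hx, hxW⟩, hi⟩) | (⟨⟨hx, hxW⟩, hi⟩ | ⟨⟨hx, hxW⟩, hi⟩))
    · exact ⟨⟨hx, (mem_frontier_cuboid hx.1).2 ⟨_, Or.inr hi⟩⟩, hxW⟩
    · exact ⟨⟨hx, (mem_frontier_cuboid hx.1).2 ⟨_, Or.inl hi⟩⟩, hxW⟩
    · exact ⟨⟨hx, (mem_frontier_cuboid hx.1).2 ⟨_, Or.inr hi⟩⟩, hxW⟩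
    · exact ⟨⟨hx, (mem_frontier_cuboid hx.1).2 ⟨_, Or.inl hi⟩⟩, hxW⟩

namespace GraphChart

variable {φ : E3 → ℝ} {k : Fin 3} {W : Set E3} {D : Set (ℝ × ℝ)} {G : ℝ × ℝ → E3}
  {U : Set E3} {A : E3 → E3} {K : Set E3} {a b : E3}

/-- On the edges `x (k + 1) = β`, the tangent `∂₂G` has the direction of `n × μ` where `s * ε` is
positive, because `(∂₁G × ∂₂G) · (e (k + 1) × ∂₂G) = ‖∂₂G‖ ^ 2`. -/
theorem setIntegral_edge_fst (h : GraphChart φ k W D G) (hU : IsOpen U)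
    (hWU : W ⊆ U) (hφ2 : ContDiffOn ℝ 2 φ U) (hgrad : ∀ x ∈ U, gradient φ x ≠ 0)
    (hab : ∀ i, a i < b i) (hWk : ∀ x ∈ W, a k < x k ∧ x k < b k)
    {s β ε : ℝ} (hs : s ^ 2 = 1) (hsn : ∀ x ∈ W, 0 < s * unitNormal φ x k)
    (hε : (β = a (k + 1) ∧ ε = -1) ∨ (β = b (k + 1) ∧ ε = 1)) :
    ∫ x in edge φ a b W (k + 1) β, circulationDensity φ a b A x ∂μHE[1]
      = (s * ε) * ∫ t in a (k + 2)..b (k + 2), pullback A D G (0, 1) (β, t) := by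
  have hε2 : ε ^ 2 = 1 := by rcases hε with ⟨-, rfl⟩ | ⟨-, rfl⟩ <;> norm_num
  refine h.setIntegral_edge (γ := fun t => (β, t)) hU hWU hφ2 hgrad hab hWk (fin_three_cases k) hε
    (by fun_prop) (fun t => (hasDerivAt_const t β).prodMk (hasDerivAt_id t)) (by simp)
    (fun t ht => h.fst_coord _ ht) (fun t ht => h.snd_coord _ ht) (fun x hx => by rw [hx])
    (fun y hy => h.fderiv_fst hy _) (by rw [mul_pow, hs, hε2, one_mul]) fun y hy => ?_
  have hyU := hWU (h.mapsTo hy)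
  have hφd : DifferentiableAt ℝ φ (G y) :=
    (hφ2.contDiffAt (hU.mem_nhds hyU)).differentiableAt two_ne_zero
  have f1 := h.fderiv_fst hy (1, 0)
  have f2 := h.fderiv_fst hy (0, 1)
  have h0 : 0 < ‖fderiv ℝ G y (0, 1)‖ ^ 2 := by
    refine pow_pos (norm_pos_iff.2 fun h0 => ?_) 2
    rw [← map_zero (fderiv ℝ G y)] at h0
    exact absurd (h.fderiv_injective hy h0) (by simp)
  have hpos := hsn _ (h.mapsTo hy)
  have hlin : cross (ε • e (k + 1)) (fderiv ℝ G y (0, 1))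
      = ε • cross (e (k + 1)) (fderiv ℝ G y (0, 1)) := by
    simp only [← crossL_apply, map_smul, _root_.smul_apply]
  rw [h.unitNormal_eq hy hφd, hlin, real_inner_smul_left, real_inner_smul_right, inner_cross_cross,
    inner_e, inner_e, f1, f2, real_inner_self_eq_norm_sq]
  have : s * ε * (unitNormal φ (G y) k * (ε * (1 * ‖fderiv ℝ G y (0, 1)‖ ^ 2
      - ⟪fderiv ℝ G y (1, 0), fderiv ℝ G y (0, 1)⟫ * 0)))
      = ε ^ 2 * ((s * unitNormal φ (G y) k) * ‖fderiv ℝ G y (0, 1)‖ ^ 2) := by ring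
  rw [this, hε2, one_mul]
  exact mul_pos hpos h0

/-- On the edges `x (k + 2) = β`, the tangent `∂₁G` has the direction of `n × μ` where `s * ε` is
negative, because `(∂₁G × ∂₂G) · (e (k + 2) × ∂₁G) = -‖∂₁G‖ ^ 2`. -/
theorem setIntegral_edge_snd (h : GraphChart φ k W D G) (hU : IsOpen U)
    (hWU : W ⊆ U) (hφ2 : ContDiffOn ℝ 2 φ U) (hgrad : ∀ x ∈ U, gradient φ x ≠ 0)
    (hab : ∀ i, a i < b i) (hWk : ∀ x ∈ W, a k < x k ∧ x k < b k)
    {s β ε : ℝ} (hs : s ^ 2 = 1) (hsn : ∀ x ∈ W, 0 < s * unitNormal φ x k)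
    (hε : (β = a (k + 2) ∧ ε = -1) ∨ (β = b (k + 2) ∧ ε = 1)) :
    ∫ x in edge φ a b W (k + 2) β, circulationDensity φ a b A x ∂μHE[1]
      = -(s * ε) * ∫ t in a (k + 1)..b (k + 1), pullback A D G (1, 0) (t, β) := by
  have hε2 : ε ^ 2 = 1 := by rcases hε with ⟨-, rfl⟩ | ⟨-, rfl⟩ <;> norm_num
  refine h.setIntegral_edge (γ := fun t => (t, β)) hU hWU hφ2 hgrad hab hWk
    (fun i => by have := fin_three_cases k i; tauto) hε
    (by fun_prop) (fun t => (hasDerivAt_id t).prodMk (hasDerivAt_const t β)) (by simp)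
    (fun t ht => h.snd_coord _ ht) (fun t ht => h.fst_coord _ ht) (fun x hx => by rw [hx])
    (fun y hy => h.fderiv_snd hy _) (by rw [neg_sq, mul_pow, hs, hε2, one_mul]) fun y hy => ?_
  have hyU := hWU (h.mapsTo hy)
  have hφd : DifferentiableAt ℝ φ (G y) :=
    (hφ2.contDiffAt (hU.mem_nhds hyU)).differentiableAt two_ne_zero
  have f1 := h.fderiv_snd hy (1, 0)
  have f2 := h.fderiv_snd hy (0, 1)
  have h0 : 0 < ‖fderiv ℝ G y (1, 0)‖ ^ 2 := by
    refine pow_pos (norm_pos_iff.2 fun h0 => ?_) 2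
    rw [← map_zero (fderiv ℝ G y)] at h0
    exact absurd (h.fderiv_injective hy h0) (by simp)
  have hpos := hsn _ (h.mapsTo hy)
  have hlin : cross (ε • e (k + 2)) (fderiv ℝ G y (1, 0))
      = ε • cross (e (k + 2)) (fderiv ℝ G y (1, 0)) := by
    simp only [← crossL_apply, map_smul, _root_.smul_apply]
  rw [h.unitNormal_eq hy hφd, hlin, real_inner_smul_left, real_inner_smul_right, inner_cross_cross,
    inner_e, inner_e, f1, f2, real_inner_self_eq_norm_sq]
  have : -(s * ε) * (unitNormal φ (G y) k * (ε * (0 * ⟪fderiv ℝ G y (0, 1), fderiv ℝ G y (1, 0)⟫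
      - ‖fderiv ℝ G y (1, 0)‖ ^ 2 * 1)))
      = ε ^ 2 * ((s * unitNormal φ (G y) k) * ‖fderiv ℝ G y (1, 0)‖ ^ 2) := by ring
  rw [this, hε2, one_mul]
  exact mul_pos hpos h0

theorem measurableSet_edge (hφ : Continuous φ) (hW : IsOpen W) (l : Fin 3) (β : ℝ) :
    MeasurableSet (edge φ a b W l β) := by
  refine ((isClosed_midSurface hφ a b).measurableSet.inter hW.measurableSet).inter ?_
  have hl : Continuous fun x : E3 => x l := by fun_prop
  exact (isClosed_singleton.preimage hl).measurableSet

theorem setIntegral_boundaryCurve (h : GraphChart φ k W D G) (hφ : Continuous φ)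
    (hab : ∀ i, a i < b i) (hWk : ∀ x ∈ W, a k < x k ∧ x k < b k) {f : E3 → ℝ}
    (hf : ∀ x ∉ W, f x = 0) (hint : IntegrableOn f (boundaryCurve φ a b) μHE[1]) :
    ∫ x in boundaryCurve φ a b, f x ∂μHE[1]
      = (∫ x in edge φ a b W (k + 1) (b (k + 1)), f x ∂μHE[1])
        + (∫ x in edge φ a b W (k + 1) (a (k + 1)), f x ∂μHE[1])
        + ((∫ x in edge φ a b W (k + 2) (b (k + 2)), f x ∂μHE[1])
        + ∫ x in edge φ a b W (k + 2) (a (k + 2)), f x ∂μHE[1]) := by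
  have hm := fun l β => measurableSet_edge (a := a) (b := b) hφ h.isOpen_set l β
  have hΓ : MeasurableSet (boundaryCurve φ a b) :=
    ((isClosed_midSurface hφ a b).inter isClosed_frontier).measurableSet
  have hdec := boundaryCurve_inter (φ := φ) hWk
  have e1 : ∫ x in boundaryCurve φ a b, f x ∂μHE[1]
      = ∫ x in boundaryCurve φ a b ∩ W, f x ∂μHE[1] :=
    setIntegral_eq_of_subset_of_forall_sdiff_eq_zero hΓ inter_subset_left
      fun x hx => hf x fun hxW => hx.2 ⟨hx.1, hxW⟩
  have hsub : boundaryCurve φ a b ∩ W ⊆ boundaryCurve φ a b := inter_subset_left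
  rw [hdec] at hsub
  obtain ⟨h12, h34⟩ := union_subset_iff.1 hsub
  obtain ⟨h1, h2⟩ := union_subset_iff.1 h12
  obtain ⟨h3, h4⟩ := union_subset_iff.1 h34
  have hdisj : ∀ l, Disjoint (edge φ a b W l (b l)) (edge φ a b W l (a l)) := by
    intro l
    rw [Set.disjoint_left]
    rintro x ⟨-, hxb⟩ ⟨-, hxa⟩
    exact (hab l).ne (hxa.symm.trans hxb)
  -- two adjacent edges meet in at most one point of the chart
  have hnull : ∀ β β', AEDisjoint μHE[1] (edge φ a b W (k + 1) β) (edge φ a b W (k + 2) β') := by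
    intro β β'
    refine measure_mono_null (t := {G (β, β')}) ?_ (euclideanHausdorffMeasure_one_singleton _)
    rintro x ⟨⟨⟨hx, hxW⟩, hx1⟩, ⟨-, hx2⟩⟩
    rw [mem_singleton_iff, ← h.apply_coord x hxW hx.2]
    rw [show x (k + 1) = β from hx1, show x (k + 2) = β' from hx2]
  rw [e1, hdec, setIntegral_union₀, setIntegral_union, setIntegral_union]
  · exact hdisj _
  · exact hm _ _
  · exact hint.mono_set h3
  · exact hint.mono_set h4
  · exact hdisj _
  · exact hm _ _
  · exact hint.mono_set h1
  · exact hint.mono_set h2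
  · rw [AEDisjoint.union_left_iff, AEDisjoint.union_right_iff, AEDisjoint.union_right_iff]
    exact ⟨⟨hnull _ _, hnull _ _⟩, hnull _ _, hnull _ _⟩
  · exact ((hm _ _).union (hm _ _)).nullMeasurableSet
  · exact hint.mono_set h12
  · exact hint.mono_set h34

/-- **Stokes' theorem** for a vector field with support in a chart: the divergence theorem on the
parameter rectangle, applied to the pull-back of the one-form `⟪A, ·⟫`. -/
theorem stokes (h : GraphChart φ k W D G) (hφ : Continuous φ) (hU : IsOpen U)
    (hWU : W ⊆ U) (hφ2 : ContDiffOn ℝ 2 φ U) (hgrad : ∀ x ∈ U, gradient φ x ≠ 0)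
    (hab : ∀ i, a i < b i) (hWk : ∀ x ∈ W, a k < x k ∧ x k < b k)
    {s : ℝ} (hs : s ^ 2 = 1) (hsn : ∀ x ∈ W, 0 < s * unitNormal φ x k)
    (hA : ContDiffOn ℝ 1 A U) (hK : IsCompact K) (hKW : K ⊆ W) (hAK : ∀ x ∉ K, A x = 0)
    (hint : IntegrableOn (circulationDensity φ a b A) (boundaryCurve φ a b) μHE[1]) :
    ∫ x in boundaryCurve φ a b, circulationDensity φ a b A x ∂μHE[1]
      = ∫ x in midSurface φ a b, ⟪curl A x, unitNormal φ x⟫ ∂μHE[2] := by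
  have hzero : ∀ x ∉ W, circulationDensity φ a b A x = 0 := by
    intro x hx
    rw [circulationDensity, hAK x fun hxK => hx (hKW hxK), inner_zero_left]
  rw [h.setIntegral_boundaryCurve hφ hab hWk hzero hint,
    h.setIntegral_inner_curl hφ hU hWU hφ2 hgrad hA hK hKW hAK hWk hs hsn,
    h.setIntegral_edge_fst hU hWU hφ2 hgrad hab hWk hs hsn (Or.inr ⟨rfl, rfl⟩),
    h.setIntegral_edge_fst hU hWU hφ2 hgrad hab hWk hs hsn (Or.inl ⟨rfl, rfl⟩),
    h.setIntegral_edge_snd hU hWU hφ2 hgrad hab hWk hs hsn (Or.inr ⟨rfl, rfl⟩),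
    h.setIntegral_edge_snd hU hWU hφ2 hgrad hab hWk hs hsn (Or.inl ⟨rfl, rfl⟩)]
  have hp := fun w => h.contDiff_pullback hφ hU hWU hA hK hKW hAK w
  have hpd : ∀ w y, HasFDerivAt (pullback A D G w) (fderiv ℝ (pullback A D G w) y) y := fun w y =>
    ((hp w).differentiable one_ne_zero y).hasFDerivAt
  have hcd : ∀ w v, Continuous fun y => fderiv ℝ (pullback A D G w) y v := fun w v =>
    ((hp w).continuous_fderiv one_ne_zero).clm_apply continuous_const
  have hdiv := integral_divergence_prod_Icc_of_hasFDerivAt_of_le (pullback A D G (0, 1))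
    (fun y => -pullback A D G (1, 0) y) (fderiv ℝ (pullback A D G (0, 1)))
    (fun y => -fderiv ℝ (pullback A D G (1, 0)) y) (a (k + 1), a (k + 2)) (b (k + 1), b (k + 2))
    ⟨(hab _).le, (hab _).le⟩ (hp _).continuous.continuousOn (hp _).continuous.neg.continuousOn
    (fun y _ => hpd _ y) (fun y _ => (hpd _ y).neg)
    (by
      refine Continuous.integrableOn_Icc ?_
      simp only [_root_.neg_apply]
      exact (hcd _ _).add (hcd _ _).neg)
  simp only [_root_.neg_apply, ← sub_eq_add_neg, intervalIntegral.integral_neg]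
    at hdiv
  rw [hdiv]
  ring

end GraphChart

end LocalStokes

/-! ### Finiteness of length and area, integrability -/

section Global
open Topology Filter
open scoped NNReal

variable {φ : E3 → ℝ} {a b : E3} {U : Set E3}

theorem contDiffOn_unitNormal (hU : IsOpen U) (hφ2 : ContDiffOn ℝ 2 φ U)
    (hgrad : ∀ x ∈ U, gradient φ x ≠ 0) : ContDiffOn ℝ 1 (unitNormal φ) U := by
  have h1 : ContDiffOn ℝ 1 (gradient φ) U :=
    (InnerProductSpace.toDual ℝ E3).symm.contDiff.comp_contDiffOn
      (hφ2.fderiv_of_isOpen hU (m := 1) (by norm_num))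
  exact ((h1.norm ℝ hgrad).inv fun x hx => norm_ne_zero_iff.2 (hgrad x hx)).smul h1

theorem isCompact_midSurface (hφ : Continuous φ) (a b : E3) : IsCompact (midSurface φ a b) :=
  (isCompact_cuboid a b).of_isClosed_subset (isClosed_midSurface hφ a b) fun _ hx => hx.1

theorem isCompact_boundaryCurve (hφ : Continuous φ) (a b : E3) :
    IsCompact (boundaryCurve φ a b) :=
  (isCompact_midSurface hφ a b).inter_right isClosed_frontier

/-- By transversality, some coordinate direction is not normal to a face through the given point
and is not tangent to the surface there. -/
theorem exists_coordinate {x : E3} (htrans : Transversal φ a b) (hx : x ∈ midSurface φ a b) :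
    ∃ k, (a k < x k ∧ x k < b k) ∧ gradient φ x k ≠ 0 := by
  by_contra! hcon
  refine htrans x hx ?_
  rw [eq_sum_smul_e (gradient φ x)]
  have hmem : ∀ i, gradient φ x i • e i
      ∈ Submodule.span ℝ {v : E3 | ∃ i, (x i = a i ∨ x i = b i) ∧ v = e i} := by
    intro i
    by_cases hi : x i = a i ∨ x i = b i
    · exact Submodule.smul_mem _ _ (Submodule.subset_span ⟨i, hi, rfl⟩)
    · rw [not_or] at hi
      rw [hcon i ⟨lt_of_le_of_ne (hx.1 i).1 (Ne.symm hi.1), lt_of_le_of_ne (hx.1 i).2 hi.2⟩,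
        zero_smul]
      exact Submodule.zero_mem _
  exact Submodule.add_mem _ (Submodule.add_mem _ (hmem 0) (hmem 1)) (hmem 2)

theorem exists_adapted_graphChart (hU : IsOpen U) (hφ2 : ContDiffOn ℝ 2 φ U)
    (hgrad : ∀ x ∈ U, gradient φ x ≠ 0) (htrans : Transversal φ a b) {x : E3}
    (hx : x ∈ midSurface φ a b) (hxU : x ∈ U) :
    ∃ (k : Fin 3) (W : Set E3) (D : Set (ℝ × ℝ)) (G : ℝ × ℝ → E3) (s : ℝ),
      GraphChart φ k W D G ∧ x ∈ W ∧ W ⊆ U ∧ (∀ z ∈ W, a k < z k ∧ z k < b k) ∧ s ^ 2 = 1 ∧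
      ∀ z ∈ W, 0 < s * unitNormal φ z k := by
  obtain ⟨k, hk, hgk⟩ := exists_coordinate htrans hx
  have hnk : unitNormal φ x k ≠ 0 := by
    rw [unitNormal, PiLp.smul_apply, smul_eq_mul]
    exact mul_ne_zero (inv_ne_zero (norm_ne_zero_iff.2 (hgrad x hxU))) hgk
  obtain ⟨s, hs, hsn⟩ : ∃ s : ℝ, s ^ 2 = 1 ∧ 0 < s * unitNormal φ x k := by
    rcases hnk.lt_or_gt with h | h
    · exact ⟨-1, by norm_num, by linarith⟩
    · exact ⟨1, by norm_num, by linarith⟩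
  have hcoord : ∀ i, Continuous fun z : E3 => z i := fun i => by fun_prop
  have hnc : ContinuousAt (fun z => s * unitNormal φ z k) x := by
    have h1 := ((contDiffOn_unitNormal hU hφ2 hgrad).continuousOn.continuousAt (hU.mem_nhds hxU))
    exact continuousAt_const.mul ((hcoord k).continuousAt.comp h1)
  have hW₀ : U ∩ ({z | a k < z k ∧ z k < b k} ∩ {z | 0 < s * unitNormal φ z k}) ∈ 𝓝 x := by
    refine inter_mem (hU.mem_nhds hxU) (inter_mem ?_ (hnc.eventually (lt_mem_nhds hsn)))
    exact ((isOpen_lt continuous_const (hcoord k)).inter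
      (isOpen_lt (hcoord k) continuous_const)).mem_nhds hk
  have hk' : fderiv ℝ φ x (e k) ≠ 0 := by
    rwa [← inner_gradient_eq_fderiv, inner_e]
  obtain ⟨W, D, G, hch, hxW, hW⟩ :=
    exists_graphChart (hφ2.contDiffAt (hU.mem_nhds hxU)) hx.2 hk' hW₀
  exact ⟨k, W, D, G, s, hch, hxW, fun z hz => (hW hz).1, fun z hz => (hW hz).2.1, hs,
    fun z hz => (hW hz).2.2⟩

theorem euclideanHausdorffMeasure_lt_top_of_isBounded {E : Type*} [NormedAddCommGroup E]
    [NormedSpace ℝ E] [FiniteDimensional ℝ E] [MeasurableSpace E] [BorelSpace E] {d : ℕ}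
    (hd : Module.finrank ℝ E = d) {s : Set E} (hs : Bornology.IsBounded s) : μHE[d] s < ⊤ := by
  subst hd
  have := FiniteDimensional.proper_real E
  exact hs.measure_lt_top

theorem GraphChart.measure_midSurface_inter_lt_top {k : Fin 3} {W : Set E3} {D : Set (ℝ × ℝ)}
    {G : ℝ × ℝ → E3} (h : GraphChart φ k W D G) :
    μHE[2] (midSurface φ a b ∩ W) < ⊤ := by
  obtain ⟨K, hK⟩ := h.lipschitz
  have hsub : midSurface φ a b ∩ W ⊆ G '' D := fun x hx =>
    ⟨_, h.mem_dom x hx.2 hx.1.2, h.apply_coord x hx.2 hx.1.2⟩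
  refine (measure_mono hsub).trans_lt ((euclideanHausdorffMeasure_image_le_of_dist_le (g := id) 2
    fun y hy z hz => hK.dist_le_mul y hy z hz).trans_lt ?_)
  rw [image_id]
  exact ENNReal.mul_lt_top (by simp) (euclideanHausdorffMeasure_lt_top_of_isBounded
    (by simp) h.isBounded_dom)

theorem GraphChart.measure_edge_lt_top {k : Fin 3} {W : Set E3} {D : Set (ℝ × ℝ)}
    {G : ℝ × ℝ → E3} (h : GraphChart φ k W D G) {l m : Fin 3} {γ : ℝ → ℝ × ℝ} {β : ℝ}
    (hγ : Isometry γ) (hγx : ∀ x : E3, x l = β → γ (x m) = (x (k + 1), x (k + 2))) :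
    μHE[1] (edge φ a b W l β) < ⊤ := by
  obtain ⟨K, hK⟩ := h.lipschitz
  have hsub : edge φ a b W l β ⊆ (fun t => G (γ t)) '' (γ ⁻¹' D) := by
    rintro x ⟨⟨hx, hxW⟩, hxl⟩
    refine ⟨x m, ?_, ?_⟩
    · rw [mem_preimage, hγx x hxl]
      exact h.mem_dom x hxW hx.2
    · beta_reduce
      rw [hγx x hxl, h.apply_coord x hxW hx.2]
  refine (measure_mono hsub).trans_lt ((euclideanHausdorffMeasure_image_le_of_dist_le (g := id)
    (K := K) 1 fun y hy z hz => ?_).trans_lt ?_)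
  · rw [id, id, ← hγ.dist_eq]
    exact hK.dist_le_mul _ hy _ hz
  · rw [image_id]
    exact ENNReal.mul_lt_top (by simp) (euclideanHausdorffMeasure_lt_top_of_isBounded
      (by simp) (hγ.antilipschitz.isBounded_preimage h.isBounded_dom))

theorem measure_midSurface_lt_top (hφ : Continuous φ) (hU : IsOpen U)
    (hΩU : midSurface φ a b ⊆ U) (hφ2 : ContDiffOn ℝ 2 φ U)
    (hgrad : ∀ x ∈ U, gradient φ x ≠ 0) (htrans : Transversal φ a b) :
    μHE[2] (midSurface φ a b) < ⊤ := by
  refine (isCompact_midSurface hφ a b).measure_lt_top_of_nhdsWithin fun x hx => ?_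
  obtain ⟨k, W, D, G, s, hch, hxW, -⟩ :=
    exists_adapted_graphChart hU hφ2 hgrad htrans hx (hΩU hx)
  exact ⟨_, inter_mem_nhdsWithin _ (hch.isOpen_set.mem_nhds hxW),
    hch.measure_midSurface_inter_lt_top⟩

theorem measure_boundaryCurve_lt_top (hφ : Continuous φ) (hU : IsOpen U)
    (hΩU : midSurface φ a b ⊆ U) (hφ2 : ContDiffOn ℝ 2 φ U)
    (hgrad : ∀ x ∈ U, gradient φ x ≠ 0) (htrans : Transversal φ a b) :
    μHE[1] (boundaryCurve φ a b) < ⊤ := by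
  refine (isCompact_boundaryCurve hφ a b).measure_lt_top_of_nhdsWithin fun x hx => ?_
  obtain ⟨k, W, D, G, s, hch, hxW, -, hWk, -⟩ :=
    exists_adapted_graphChart hU hφ2 hgrad htrans hx.1 (hΩU hx.1)
  refine ⟨_, inter_mem_nhdsWithin _ (hch.isOpen_set.mem_nhds hxW), ?_⟩
  have h1 : ∀ β, μHE[1] (edge φ a b W (k + 1) β) < ⊤ := fun β =>
    hch.measure_edge_lt_top (m := k + 2) (γ := fun t => (β, t))
      (Isometry.of_dist_eq fun t t' => by simp [Prod.dist_eq])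
      fun x hx => by rw [hx]
  have h2 : ∀ β, μHE[1] (edge φ a b W (k + 2) β) < ⊤ := fun β =>
    hch.measure_edge_lt_top (m := k + 1) (γ := fun t => (t, β))
      (Isometry.of_dist_eq fun t t' => by simp [Prod.dist_eq])
      fun x hx => by rw [hx]
  rw [boundaryCurve_inter hWk]
  exact measure_union_lt_top (measure_union_lt_top (h1 _) (h1 _))
    (measure_union_lt_top (h2 _) (h2 _))

/-- The Hausdorff measures are not locally finite on space, so only finiteness on `s` itself is
assumed. -/
theorem integrableOn_of_isCompact_of_continuousOn {V : Type*} [NormedAddCommGroup V]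
    {μ : Measure E3} {s : Set E3} (hs : IsCompact s) (hμ : μ s < ⊤) {f : E3 → V}
    (hf : ContinuousOn f s) : IntegrableOn f s μ := by
  obtain ⟨C, hC⟩ := hs.exists_bound_of_continuousOn hf
  have : IsFiniteMeasure (μ.restrict s) := ⟨by simpa using hμ⟩
  exact Integrable.of_bound (hf.aestronglyMeasurable_of_isCompact hs hs.measurableSet) C
    (ae_restrict_of_forall_mem hs.measurableSet hC)

theorem norm_conormal_le (φ : E3 → ℝ) (a b x : E3) : ‖conormal φ a b x‖ ≤ 1 := by
  rw [conormal, norm_smul, norm_inv, norm_norm]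
  exact inv_mul_le_one

theorem measurable_cuboidNormal (a b : E3) : Measurable (cuboidNormal a b) := by
  refine Finset.measurable_sum _ fun i _ => ?_
  have hi : Measurable fun x : E3 => x i := (by fun_prop : Continuous fun x : E3 => x i).measurable
  refine Measurable.smul_const ?_ _
  refine Measurable.ite (hi (measurableSet_singleton _)) measurable_const ?_
  exact Measurable.ite (hi (measurableSet_singleton _)) measurable_const measurable_const

theorem aestronglyMeasurable_conormal (hφ : Continuous φ) (hU : IsOpen U)
    (hΩU : midSurface φ a b ⊆ U) (hφ2 : ContDiffOn ℝ 2 φ U) (hgrad : ∀ x ∈ U, gradient φ x ≠ 0) :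
    AEStronglyMeasurable (conormal φ a b) (μHE[1].restrict (boundaryCurve φ a b)) := by
  have hn : AEStronglyMeasurable (unitNormal φ) (μHE[1].restrict (boundaryCurve φ a b)) :=
    (((contDiffOn_unitNormal hU hφ2 hgrad).continuousOn).mono
      fun x hx => hΩU hx.1).aestronglyMeasurable_of_isCompact (isCompact_boundaryCurve hφ a b)
      (isCompact_boundaryCurve hφ a b).measurableSet
  have hν : AEStronglyMeasurable (cuboidNormal a b) (μHE[1].restrict (boundaryCurve φ a b)) :=
    (measurable_cuboidNormal a b).aestronglyMeasurable
  have hP : AEStronglyMeasurable (fun x => projector φ x (cuboidNormal a b x))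
      (μHE[1].restrict (boundaryCurve φ a b)) := by
    simp only [projector_apply]
    exact hν.sub ((hn.inner (𝕜 := ℝ) hν).smul hn)
  exact hP.norm.aemeasurable.inv.aestronglyMeasurable.smul hP

/-- Continuous fields of linear maps applied to the conormal are integrable along the boundary
curve, although the conormal may jump at corners. -/
theorem integrableOn_apply_conormal {V : Type*} [NormedAddCommGroup V] [NormedSpace ℝ V]
    (hφ : Continuous φ) (hU : IsOpen U)
    (hΩU : midSurface φ a b ⊆ U) (hφ2 : ContDiffOn ℝ 2 φ U) (hgrad : ∀ x ∈ U, gradient φ x ≠ 0)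
    (htrans : Transversal φ a b) {L : E3 → E3 →L[ℝ] V} (hL : ContinuousOn L U) :
    IntegrableOn (fun x => L x (conormal φ a b x)) (boundaryCurve φ a b) μHE[1] := by
  have hcomp := isCompact_boundaryCurve hφ a b
  have hL' : ContinuousOn L (boundaryCurve φ a b) := hL.mono fun x hx => hΩU hx.1
  obtain ⟨C, hC⟩ := hcomp.exists_bound_of_continuousOn hL'
  have : IsFiniteMeasure (μHE[1].restrict (boundaryCurve φ a b)) :=
    ⟨by simpa using measure_boundaryCurve_lt_top hφ hU hΩU hφ2 hgrad htrans⟩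
  refine Integrable.of_bound (C := C) ?_ (ae_restrict_of_forall_mem hcomp.measurableSet ?_)
  · exact isBoundedBilinearMap_apply.continuous.comp_aestronglyMeasurable₂
      (hL'.aestronglyMeasurable_of_isCompact hcomp hcomp.measurableSet)
      (aestronglyMeasurable_conormal hφ hU hΩU hφ2 hgrad)
  · intro x hx
    calc ‖L x (conormal φ a b x)‖ ≤ ‖L x‖ * ‖conormal φ a b x‖ := (L x).le_opNorm _
      _ ≤ ‖L x‖ * 1 := by gcongr; exact norm_conormal_le _ _ _ _
      _ ≤ C := by rw [mul_one]; exact hC x hx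

end Global

/-! ### Stokes' theorem on the surface -/

section GlobalStokes
open Topology Filter

variable {φ : E3 → ℝ} {a b : E3} {U : Set E3}

theorem integrableOn_circulationDensity
    (hφ : Continuous φ) (hU : IsOpen U)
    (hΩU : midSurface φ a b ⊆ U) (hφ2 : ContDiffOn ℝ 2 φ U) (hgrad : ∀ x ∈ U, gradient φ x ≠ 0)
    (htrans : Transversal φ a b) {A : E3 → E3} (hA : ContinuousOn A U) :
    IntegrableOn (circulationDensity φ a b A) (boundaryCurve φ a b) μHE[1] := by
  have hn := (contDiffOn_unitNormal hU hφ2 hgrad).continuousOn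
  have hL : ContinuousOn (fun x => (innerSL ℝ (A x)).comp (crossL (unitNormal φ x))) U :=
    ((innerSL ℝ (E := E3)).continuous.comp_continuousOn hA).clm_comp
      (crossL.continuous.comp_continuousOn hn)
  exact integrableOn_apply_conormal hφ hU hΩU hφ2 hgrad htrans hL

theorem continuousOn_curl (hU : IsOpen U) {A : E3 → E3} (hA : ContDiffOn ℝ 1 A U) :
    ContinuousOn (curl A) U := by
  have hc := fun v => (hA.continuousOn_fderiv_of_isOpen hU le_rfl).clm_apply
    (continuousOn_const (c := v))
  have h : ContinuousOn (fun x => crossVec (fderiv ℝ A x)) U := by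
    refine continuousOn_finsetSum _ fun i _ => continuousOn_finsetSum _ fun j _ => ?_
    have hi : Continuous fun z : E3 => z i := by fun_prop
    exact (hi.comp_continuousOn (hc (e j))).smul continuousOn_const
  exact h.neg

theorem integrableOn_inner_curl
    (hφ : Continuous φ) (hU : IsOpen U)
    (hΩU : midSurface φ a b ⊆ U) (hφ2 : ContDiffOn ℝ 2 φ U) (hgrad : ∀ x ∈ U, gradient φ x ≠ 0)
    (htrans : Transversal φ a b) {A : E3 → E3} (hA : ContDiffOn ℝ 1 A U) :
    IntegrableOn (fun x => ⟪curl A x, unitNormal φ x⟫) (midSurface φ a b) μHE[2] :=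
  integrableOn_of_isCompact_of_continuousOn (isCompact_midSurface hφ a b)
    (measure_midSurface_lt_top hφ hU hΩU hφ2 hgrad htrans)
    (((continuousOn_curl hU hA).inner
      (contDiffOn_unitNormal hU hφ2 hgrad).continuousOn).mono hΩU)

/-- The circulation of `A` along the boundary curve minus the flux of its curl. -/
noncomputable def stokesDefect (φ : E3 → ℝ) (a b : E3) (A : E3 → E3) : ℝ :=
  (∫ x in boundaryCurve φ a b, circulationDensity φ a b A x ∂μHE[1])
    - ∫ x in midSurface φ a b, ⟪curl A x, unitNormal φ x⟫ ∂μHE[2]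

theorem stokesDefect_add (hφ : Continuous φ) (hU : IsOpen U)
    (hΩU : midSurface φ a b ⊆ U) (hφ2 : ContDiffOn ℝ 2 φ U) (hgrad : ∀ x ∈ U, gradient φ x ≠ 0)
    (htrans : Transversal φ a b) {A B : E3 → E3} (hA : ContDiffOn ℝ 1 A U)
    (hB : ContDiffOn ℝ 1 B U) :
    stokesDefect φ a b (fun x => A x + B x) = stokesDefect φ a b A + stokesDefect φ a b B := by
  have e1 : ∫ x in boundaryCurve φ a b, circulationDensity φ a b (fun x => A x + B x) x ∂μHE[1]
      = (∫ x in boundaryCurve φ a b, circulationDensity φ a b A x ∂μHE[1])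
        + ∫ x in boundaryCurve φ a b, circulationDensity φ a b B x ∂μHE[1] := by
    rw [← integral_add
      (integrableOn_circulationDensity hφ hU hΩU hφ2 hgrad htrans hA.continuousOn)
      (integrableOn_circulationDensity hφ hU hΩU hφ2 hgrad htrans hB.continuousOn)]
    simp only [circulationDensity, inner_add_left]
  have e2 : ∫ x in midSurface φ a b, ⟪curl (fun x => A x + B x) x, unitNormal φ x⟫ ∂μHE[2]
      = (∫ x in midSurface φ a b, ⟪curl A x, unitNormal φ x⟫ ∂μHE[2])
        + ∫ x in midSurface φ a b, ⟪curl B x, unitNormal φ x⟫ ∂μHE[2] := by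
    rw [← integral_add
      (integrableOn_inner_curl hφ hU hΩU hφ2 hgrad htrans hA)
      (integrableOn_inner_curl hφ hU hΩU hφ2 hgrad htrans hB)]
    refine setIntegral_congr_fun (isClosed_midSurface hφ a b).measurableSet fun x hx => ?_
    have hxU := hU.mem_nhds (hΩU hx)
    have hcurl : curl (fun x => A x + B x) x = curl A x + curl B x := by
      rw [curl, fderiv_fun_add ((hA.contDiffAt hxU).differentiableAt one_ne_zero)
        ((hB.contDiffAt hxU).differentiableAt one_ne_zero), curl, curl]
      simp only [crossVec, _root_.add_apply, PiLp.add_apply, add_smul, Finset.sum_add_distrib,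
        neg_add]
    rw [hcurl, inner_add_left]
  rw [stokesDefect, e1, e2, stokesDefect, stokesDefect]
  ring

theorem stokesDefect_eq_zero_of_eq_zero_nhds (hφ : Continuous φ) {A : E3 → E3} {V : Set E3}
    (hV : IsOpen V) (hΩV : midSurface φ a b ⊆ V) (hA : ∀ x ∈ V, A x = 0) :
    stokesDefect φ a b A = 0 := by
  have hΓ : MeasurableSet (boundaryCurve φ a b) := (isCompact_boundaryCurve hφ a b).measurableSet
  rw [stokesDefect, setIntegral_eq_zero_of_forall_eq_zero, setIntegral_eq_zero_of_forall_eq_zero,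
    sub_zero]
  · intro x hx
    have : A =ᶠ[𝓝 x] fun _ => 0 := (hV.eventually_mem (hΩV hx)).mono fun z hz => hA z hz
    rw [curl, this.fderiv_eq]
    simp [crossVec]
  · intro x hx
    rw [circulationDensity, hA x (hΩV hx.1), inner_zero_left]

/-- **Stokes' theorem** on the surface. The local case is propagated by compactness: over a larger
and larger part of the surface, the field is cut off without changing the two integrals'
difference, until it vanishes near the whole surface. -/
theorem stokesDefect_eq_zero (hab : ∀ i, a i < b i) (hφ : Continuous φ) (hU : IsOpen U)
    (hΩU : midSurface φ a b ⊆ U) (hφ2 : ContDiffOn ℝ 2 φ U) (hgrad : ∀ x ∈ U, gradient φ x ≠ 0)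
    (htrans : Transversal φ a b) {A : E3 → E3} (hA : ContDiffOn ℝ 1 A U) :
    stokesDefect φ a b A = 0 := by
  have key : ∃ (F : E3 → ℝ) (V : Set E3), ContDiff ℝ 1 F ∧ IsOpen V ∧ midSurface φ a b ⊆ V ∧
      (∀ x ∈ V, F x = 0) ∧ ∀ A : E3 → E3, ContDiffOn ℝ 1 A U →
        stokesDefect φ a b A = stokesDefect φ a b (fun x => F x • A x) := by
    refine (isCompact_midSurface hφ a b).induction_on
      (p := fun t => ∃ (F : E3 → ℝ) (V : Set E3), ContDiff ℝ 1 F ∧ IsOpen V ∧ t ⊆ V ∧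
        (∀ x ∈ V, F x = 0) ∧ ∀ A : E3 → E3, ContDiffOn ℝ 1 A U →
        stokesDefect φ a b A = stokesDefect φ a b (fun x => F x • A x)) ?_ ?_ ?_ ?_
    · exact ⟨fun _ => 1, ∅, contDiff_const, isOpen_empty, Subset.rfl, by simp, by simp⟩
    · rintro t t' htt' ⟨F, V, hF, hV, htV, hFV, H⟩
      exact ⟨F, V, hF, hV, htt'.trans htV, hFV, H⟩
    · rintro t t' ⟨F, V, hF, hV, htV, hFV, H⟩ ⟨F', V', hF', hV', htV', hFV', H'⟩
      refine ⟨fun x => F' x * F x, V ∪ V', hF'.mul hF, hV.union hV', union_subset_union htV htV',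
        ?_, fun A hA => ?_⟩
      · rintro x (hx | hx)
        · simp only [hFV x hx, mul_zero]
        · simp only [hFV' x hx, zero_mul]
      · have hFA : ContDiffOn ℝ 1 (fun x => F x • A x) U := hF.contDiffOn.smul hA
        rw [H A hA, H' _ hFA]
        simp only [mul_smul]
    · intro x hx
      obtain ⟨k, W, D, G, s, hch, hxW, hWU, hWk, hs, hsn⟩ :=
        exists_adapted_graphChart hU hφ2 hgrad htrans hx (hΩU hx)
      obtain ⟨r, hr, hrW⟩ := Metric.nhds_basis_closedBall.mem_iff.1 (hch.isOpen_set.mem_nhds hxW)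
      let f : ContDiffBump x := ⟨r / 2, r, half_pos hr, half_lt_self hr⟩
      refine ⟨Metric.ball x (r / 2) ∩ midSurface φ a b,
        inter_mem (mem_nhdsWithin_of_mem_nhds (Metric.ball_mem_nhds x (half_pos hr)))
          self_mem_nhdsWithin,
        fun z => 1 - f z, Metric.ball x (r / 2), contDiff_const.sub f.contDiff, Metric.isOpen_ball,
        inter_subset_left, fun z hz => ?_, fun A hA => ?_⟩
      · simp only [f.one_of_mem_closedBall (Metric.ball_subset_closedBall hz), sub_self]
      · have hfA : ContDiffOn ℝ 1 (fun z => f z • A z) U := f.contDiff.contDiffOn.smul hA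
        have hfA' : ContDiffOn ℝ 1 (fun z => (1 - f z) • A z) U :=
          (contDiff_const.sub f.contDiff).contDiffOn.smul hA
        have hsplit : A = fun z => f z • A z + (1 - f z) • A z := by
          funext z
          rw [← add_smul, add_sub_cancel, one_smul]
        have hzero : stokesDefect φ a b (fun z => f z • A z) = 0 := by
          rw [stokesDefect, sub_eq_zero]
          refine hch.stokes hφ hU hWU hφ2 hgrad hab hWk hs hsn hfA (isCompact_closedBall x r) hrW
            (fun z hz => ?_)
            (integrableOn_circulationDensity hφ hU hΩU hφ2 hgrad htrans hfA.continuousOn)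
          rw [f.zero_of_le_dist (le_of_lt (by simpa using hz)), zero_smul]
        conv_lhs => rw [hsplit]
        rw [stokesDefect_add hφ hU hΩU hφ2 hgrad htrans hfA hfA', hzero, zero_add]
  obtain ⟨F, V, -, hV, hΩV, hFV, H⟩ := key
  rw [H A hA]
  exact stokesDefect_eq_zero_of_eq_zero_nhds hφ hV hΩV fun x hx => by rw [hFV x hx, zero_smul]

end GlobalStokes

/-! ### The divergence theorem on the surface -/

section SurfaceDivergence
open Topology Filter

variable {φ : E3 → ℝ} {a b : E3} {U : Set E3}

/-- The vector `Tᵀ · c`, as a continuous linear function of the tensor `T`. -/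
noncomputable def rowL (c : E3) : Tensor2 →L[ℝ] E3 :=
  ∑ l, ((innerSL ℝ c).comp (ContinuousLinearMap.apply ℝ E3 (e l))).smulRight (e l)

theorem rowL_apply (c : E3) (T : Tensor2) (l : Fin 3) : rowL c T l = ⟪c, T (e l)⟫ := by
  fin_cases l <;> simp [rowL, Fin.sum_univ_three, e_apply]

theorem inner_rowL (c : E3) (T : Tensor2) (w : E3) : ⟪rowL c T, w⟫ = ⟪c, T w⟫ := by
  conv_rhs => rw [eq_sum_smul_e w]
  simp only [map_add, map_smul, inner_add_right, real_inner_smul_right]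
  rw [inner_eq_sum, rowL_apply, rowL_apply, rowL_apply]
  ring

theorem apply_eq_sum_coord (T : Tensor2) (v : E3) (i : Fin 3) :
    T v i = v 0 * T (e 0) i + v 1 * T (e 1) i + v 2 * T (e 2) i := by
  conv_lhs => rw [eq_sum_smul_e v]
  simp

/-- The formula `n · curl (n × V) = ∇V : P + (tr H) V · n` for a field `n` of unit vectors; here
`N` and `L` are the derivatives of `n` and `V`. -/
theorem inner_crossVec_bilinear {n V : E3} {N L : Tensor2} (hn : ⟪n, n⟫ = 1)
    (hN : ∀ v, ⟪N v, n⟫ = 0) :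
    ⟪-crossVec ((crossL n).comp L + (crossL.flip V).comp N), n⟫
      = ∑ k, ⟪L (e k), e k - ⟪n, e k⟫ • n⟫
        - (∑ k, N (e k - ⟪n, e k⟫ • n) k) * ⟪V, n⟫ := by
  have h0 := hN (e 0)
  have h1 := hN (e 1)
  have h2 := hN (e 2)
  rw [inner_eq_sum] at hn h0 h1 h2
  have hsub : ∀ k, N (e k - ⟪n, e k⟫ • n) k = N (e k) k - n k * N n k := by
    intro k
    simp [inner_e]
  have hNn := fun i => apply_eq_sum_coord N n i
  simp only [Fin.sum_univ_three, hsub, hNn]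
  simp only [inner_sub_right, real_inner_smul_right, inner_e]
  simp only [inner_eq_sum, PiLp.neg_apply, crossVec_apply_zero, crossVec_apply_one,
    crossVec_apply_two, _root_.add_apply, ContinuousLinearMap.comp_apply, crossL_apply,
    ContinuousLinearMap.flip_apply, PiLp.add_apply, cross_coords]
  linear_combination (L (e 0) 0 + L (e 1) 1 + L (e 2) 2) * hn
    + V 0 * h0 + V 1 * h1 + V 2 * h2
    - (V 0 * n 0 + V 1 * n 1 + V 2 * n 2) * (n 0 * h0 + n 1 * h1 + n 2 * h2)

theorem inner_fderiv_unitNormal (hU : IsOpen U) (hφ2 : ContDiffOn ℝ 2 φ U)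
    (hgrad : ∀ x ∈ U, gradient φ x ≠ 0) {x : E3} (hx : x ∈ U) (v : E3) :
    ⟪fderiv ℝ (unitNormal φ) x v, unitNormal φ x⟫ = 0 := by
  have hd : DifferentiableAt ℝ (unitNormal φ) x :=
    ((contDiffOn_unitNormal hU hφ2 hgrad).contDiffAt (hU.mem_nhds hx)).differentiableAt one_ne_zero
  have h1 : (fun z => ⟪unitNormal φ z, unitNormal φ z⟫) =ᶠ[𝓝 x] fun _ => (1 : ℝ) := by
    filter_upwards [hU.mem_nhds hx] with z hz
    rw [real_inner_self_eq_norm_sq, norm_unitNormal (hgrad z hz), one_pow]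
  have h2 := fderiv_inner_apply ℝ hd hd v
  rw [h1.fderiv_eq, real_inner_comm] at h2
  simp only [fderiv_fun_const, Pi.zero_apply, _root_.zero_apply] at h2
  linarith

/-- The flux density of `curl (n × (Tᵀ · c))` is the component along `c` of the surface divergence
of `T`, the curvature term included. -/
theorem inner_curl_cross_rowL (hU : IsOpen U) (hφ2 : ContDiffOn ℝ 2 φ U)
    (hgrad : ∀ x ∈ U, gradient φ x ≠ 0) {T : E3 → Tensor2} (hT : ContDiffOn ℝ 1 T U) (c : E3)
    {x : E3} (hx : x ∈ U) :
    ⟪curl (fun z => cross (unitNormal φ z) (rowL c (T z))) x, unitNormal φ x⟫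
      = ⟪c, surfaceDiv φ T x⟫ := by
  have hnd : DifferentiableAt ℝ (unitNormal φ) x :=
    ((contDiffOn_unitNormal hU hφ2 hgrad).contDiffAt (hU.mem_nhds hx)).differentiableAt one_ne_zero
  have hTd : DifferentiableAt ℝ T x :=
    (hT.contDiffAt (hU.mem_nhds hx)).differentiableAt one_ne_zero
  have hVd : HasFDerivAt (fun z => rowL c (T z)) ((rowL c).comp (fderiv ℝ T x)) x :=
    (rowL c).hasFDerivAt.comp x hTd.hasFDerivAt
  have hAd := crossL.hasFDerivAt_of_bilinear hnd.hasFDerivAt hVd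
  have hA : fderiv ℝ (fun z => cross (unitNormal φ z) (rowL c (T z))) x
      = (crossL (unitNormal φ x)).comp ((rowL c).comp (fderiv ℝ T x))
        + (crossL.flip (rowL c (T x))).comp (fderiv ℝ (unitNormal φ) x) := by
    refine (hAd.fderiv).trans ?_
    ext v : 1
    simp
  have hnn : ⟪unitNormal φ x, unitNormal φ x⟫ = 1 := by
    rw [real_inner_self_eq_norm_sq, norm_unitNormal (hgrad x hx), one_pow]
  rw [curl, hA, inner_crossVec_bilinear hnn (inner_fderiv_unitNormal hU hφ2 hgrad hx), surfaceDiv,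
    inner_add_right, inner_sum, real_inner_smul_right, inner_rowL, sub_eq_add_neg, ← neg_mul,
    meanCurvature]
  congr 1
  · refine Finset.sum_congr rfl fun k _ => ?_
    rw [ContinuousLinearMap.comp_apply, inner_rowL, projector_apply]
  · congr 1
    rw [← Finset.sum_neg_distrib]
    refine Finset.sum_congr rfl fun k _ => ?_
    simp only [weingarten, _root_.neg_apply, ContinuousLinearMap.comp_apply, projector_apply,
      PiLp.neg_apply]

theorem inner_unitNormal_conormal (hgrad : ∀ x ∈ U, gradient φ x ≠ 0) {x : E3} (hx : x ∈ U) :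
    ⟪unitNormal φ x, conormal φ a b x⟫ = 0 := by
  rw [conormal, projector_apply, real_inner_smul_right, inner_sub_right, real_inner_smul_right,
    real_inner_self_eq_norm_sq, norm_unitNormal (hgrad x hx)]
  ring

theorem continuousOn_projector (hn : ContinuousOn (unitNormal φ) U) (v : E3) :
    ContinuousOn (fun x => projector φ x v) U := by
  simp only [projector_apply]
  exact continuousOn_const.sub ((hn.inner (𝕜 := ℝ) continuousOn_const).smul hn)

theorem continuousOn_surfaceDiv (hU : IsOpen U) (hφ2 : ContDiffOn ℝ 2 φ U)
    (hgrad : ∀ x ∈ U, gradient φ x ≠ 0) {T : E3 → Tensor2} (hT : ContDiffOn ℝ 1 T U) :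
    ContinuousOn (surfaceDiv φ T) U := by
  have hn1 := contDiffOn_unitNormal hU hφ2 hgrad
  have hn := hn1.continuousOn
  have hP := fun v => continuousOn_projector hn v
  have hT' := hT.continuousOn_fderiv_of_isOpen hU le_rfl
  have hn' := hn1.continuousOn_fderiv_of_isOpen hU le_rfl
  have hH : ContinuousOn (meanCurvature φ) U := by
    refine continuousOn_finsetSum _ fun i _ => ?_
    have hi : Continuous fun z : E3 => z i := by fun_prop
    exact hi.comp_continuousOn (hn'.clm_apply (hP _)).neg
  exact (continuousOn_finsetSum _ fun k _ =>
    (hT'.clm_apply continuousOn_const).clm_apply (hP _)).add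
      (hH.smul (hT.continuousOn.clm_apply hn))

/-- The **divergence theorem** on the surface, for tensor fields that need not be tangential: it is
Stokes' theorem for the fields `n × (Tᵀ · c)`. -/
theorem setIntegral_apply_conormal_eq_setIntegral_surfaceDiv (hab : ∀ i, a i < b i)
    (hφ : Continuous φ) (hU : IsOpen U)
    (hΩU : midSurface φ a b ⊆ U) (hφ2 : ContDiffOn ℝ 2 φ U) (hgrad : ∀ x ∈ U, gradient φ x ≠ 0)
    (htrans : Transversal φ a b) {T : E3 → Tensor2} (hT : ContDiffOn ℝ 1 T U) :
    IntegrableOn (fun x => T x (conormal φ a b x)) (boundaryCurve φ a b) μHE[1] ∧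
    IntegrableOn (surfaceDiv φ T) (midSurface φ a b) μHE[2] ∧
    ∫ x in boundaryCurve φ a b, T x (conormal φ a b x) ∂μHE[1]
      = ∫ x in midSurface φ a b, surfaceDiv φ T x ∂μHE[2] := by
  have hi1 := integrableOn_apply_conormal hφ hU hΩU hφ2 hgrad htrans hT.continuousOn
  have hi2 : IntegrableOn (surfaceDiv φ T) (midSurface φ a b) μHE[2] :=
    integrableOn_of_isCompact_of_continuousOn (isCompact_midSurface hφ a b)
      (measure_midSurface_lt_top hφ hU hΩU hφ2 hgrad htrans)
      ((continuousOn_surfaceDiv hU hφ2 hgrad hT).mono hΩU)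
  refine ⟨hi1, hi2, ext_inner_left ℝ fun c => ?_⟩
  have hA : ContDiffOn ℝ 1 (fun z => cross (unitNormal φ z) (rowL c (T z))) U :=
    (crossL.contDiff.comp_contDiffOn (contDiffOn_unitNormal hU hφ2 hgrad)).clm_apply
      ((rowL c).contDiff.comp_contDiffOn hT)
  have hst := sub_eq_zero.1 (stokesDefect_eq_zero hab hφ hU hΩU hφ2 hgrad htrans hA)
  rw [← integral_inner hi1, ← integral_inner hi2]
  refine Eq.trans ?_ (hst.trans ?_)
  · refine setIntegral_congr_fun (isCompact_boundaryCurve hφ a b).measurableSet fun x hx => ?_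
    have hxU := hΩU hx.1
    simp only [circulationDensity]
    rw [inner_cross_cross, real_inner_self_eq_norm_sq, norm_unitNormal (hgrad x hxU),
      inner_unitNormal_conormal hgrad hxU, inner_rowL]
    ring
  · exact setIntegral_congr_fun (isClosed_midSurface hφ a b).measurableSet fun x hx =>
      inner_curl_cross_rowL hU hφ2 hgrad hT c (hΩU hx)

end SurfaceDivergence

/-! ### The total moment as a surface divergence -/

section Moment
open Topology Filter

variable {φ : E3 → ℝ} {a b : E3} {U : Set E3}

theorem transp_apply (T : Tensor2) (i j : Fin 3) : transp T (e j) i = T (e i) j := by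
  rw [← inner_e, transp, ContinuousLinearMap.adjoint_inner_left, real_inner_comm, inner_e]

theorem transp_comp_projector (φ : E3 → ℝ) (x : E3) (T : Tensor2) :
    transp (T.comp (projector φ x)) = (projector φ x).comp (transp T) := by
  have hP : ContinuousLinearMap.adjoint (projector φ x) = projector φ x := by
    rw [eq_comm, ContinuousLinearMap.eq_adjoint_iff]
    intro u v
    simp only [projector_apply, inner_sub_left, inner_sub_right, real_inner_smul_right,
      real_inner_comm]
    ring
  rw [transp, ContinuousLinearMap.adjoint_comp, hP, transp]

theorem crossVec_add (S T : Tensor2) : crossVec (S + T) = crossVec S + crossVec T := by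
  simp only [crossVec, _root_.add_apply, PiLp.add_apply, add_smul, Finset.sum_add_distrib]

/-- The axial vector of `X · Yᵀ`. -/
theorem sum_cross_apply (X Y : Tensor2) :
    ∑ k, cross (X (e k)) (Y (e k)) = crossVec (X.comp (transp Y)) := by
  have hX := fun v => apply_eq_sum_coord X v
  apply ext_three <;>
    simp only [crossVec_apply_zero, crossVec_apply_one, crossVec_apply_two, Fin.sum_univ_three,
      PiLp.add_apply, cross_coords, ContinuousLinearMap.comp_apply, hX (transp _ _),
      transp_apply] <;> ring

/-- The tensor field whose flux through the boundary curve is the density `m + x × t` of the total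
moment. -/
noncomputable def momentTensor (φ : E3 → ℝ) (N M : E3 → Tensor2) (S : E3 → E3) (x : E3) : Tensor2 :=
  (crossL (unitNormal φ x)).comp (M x) + (crossL x).comp (stress φ N S x)

theorem contDiffOn_stress {N : E3 → Tensor2} {S : E3 → E3}
    (hn : ContDiffOn ℝ 1 (unitNormal φ) U) (hN : ContDiffOn ℝ 1 N U) (hS : ContDiffOn ℝ 1 S U) :
    ContDiffOn ℝ 1 (stress φ N S) U :=
  hN.add (((innerSL ℝ (E := E3)).contDiff.comp_contDiffOn hS).smulRight hn)

/-- The product rule for the surface divergence of `n × M + x × σ`. The derivatives of `n`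
and of the position vector each contribute the axial vector of a tensor. -/
theorem surfaceDiv_momentTensor {N M : E3 → Tensor2} {S : E3 → E3} {x : E3}
    (hn : DifferentiableAt ℝ (unitNormal φ) x) (hM : DifferentiableAt ℝ M x)
    (hσ : DifferentiableAt ℝ (stress φ N S) x) :
    surfaceDiv φ (momentTensor φ N M S) x
      = crossVec (-((weingarten φ x).comp (transp (M x))))
        + cross (unitNormal φ x) (surfaceDiv φ M x)
        + crossVec (transp ((stress φ N S x).comp (projector φ x)))
        + cross x (surfaceDiv φ (stress φ N S) x) := by
  set n := unitNormal φ
  set σ := stress φ N S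
  set P := projector φ x
  have hd : ∀ k, fderiv ℝ (momentTensor φ N M S) x (e k) (P (e k))
      = cross (fderiv ℝ n x (e k)) ((M x).comp P (e k)) + cross (n x) (fderiv ℝ M x (e k) (P (e k)))
        + cross (e k) ((σ x).comp P (e k)) + cross x (fderiv ℝ σ x (e k) (P (e k))) := by
    intro k
    have h1 : DifferentiableAt ℝ (fun z => crossL (n z)) x := crossL.differentiableAt.comp x hn
    have h2 : DifferentiableAt ℝ (fun z : E3 => crossL z) x := crossL.differentiableAt
    have e1 : fderiv ℝ (fun z => crossL (n z)) x = crossL.comp (fderiv ℝ n x) :=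
      (crossL.hasFDerivAt.comp x hn.hasFDerivAt).fderiv
    have e2 : fderiv ℝ (fun z : E3 => crossL z) x = crossL := crossL.fderiv
    have e3 : fderiv ℝ (momentTensor φ N M S) x
        = fderiv ℝ (fun z => (crossL (n z)).comp (M z) + (crossL z).comp (σ z)) x := rfl
    rw [e3, fderiv_fun_add (h1.clm_comp hM) (h2.clm_comp hσ), fderiv_clm_comp h1 hM,
      fderiv_clm_comp h2 hσ, e1, e2]
    simp
    abel
  have hT : ∀ T : E3 → Tensor2, surfaceDiv φ T x
      = (∑ k, fderiv ℝ T x (e k) (P (e k))) + meanCurvature φ x • T x (n x) := fun _ => rfl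
  have hlin : ∀ u (f : Fin 3 → E3), cross u (∑ k, f k) = ∑ k, cross u (f k) := fun u f => by
    simp only [← crossL_apply, map_sum]
  have hlin2 : ∀ (u v w : E3) (c : ℝ), cross u (v + c • w) = cross u v + c • cross u w :=
    fun u v w c => by simp only [← crossL_apply, map_add, map_smul]
  have hH : -((weingarten φ x).comp (transp (M x)))
      = (fderiv ℝ n x).comp (transp ((M x).comp P)) := by
    rw [transp_comp_projector, weingarten, ContinuousLinearMap.neg_comp, neg_neg,
      ContinuousLinearMap.comp_assoc]
  have hid : crossVec (transp ((σ x).comp P)) = ∑ k, cross (e k) ((σ x).comp P (e k)) := by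
    have := sum_cross_apply (ContinuousLinearMap.id ℝ E3) ((σ x).comp P)
    rw [ContinuousLinearMap.id_comp] at this
    rw [← this]
    rfl
  have hQ : momentTensor φ N M S x (n x) = cross (n x) (M x (n x)) + cross x (σ x (n x)) := rfl
  rw [hT, hT M, hT σ, hlin2, hlin2, hlin, hlin, hH, ← sum_cross_apply, hid,
    Finset.sum_congr rfl fun k _ => hd k, hQ]
  simp only [Finset.sum_add_distrib, smul_add]
  abel

/-- The local balance of moments: the shear condition cancels the couple `S × n` of the stress
tensor against `n × div M`, and what remains of the couples is the antisymmetric part of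
`-H · Mᵀ + Nᵀ`. -/
theorem surfaceDiv_momentTensor_eq {N M : E3 → Tensor2} {S : E3 → E3} {x : E3}
    (hn : DifferentiableAt ℝ (unitNormal φ) x) (hM : DifferentiableAt ℝ M x)
    (hσ : DifferentiableAt ℝ (stress φ N S) x) (hgrad : gradient φ x ≠ 0)
    (hNtan : (projector φ x).comp ((N x).comp (projector φ x)) = N x)
    (hStan : ⟪S x, unitNormal φ x⟫ = 0) (hshear : S x = projector φ x (surfaceDiv φ M x)) :
    surfaceDiv φ (momentTensor φ N M S) x
      = crossVec (-((weingarten φ x).comp (transp (M x))) + transp (N x))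
        + cross x (surfaceDiv φ (stress φ N S) x) := by
  set n := unitNormal φ x with hn'
  have hnn : ⟪n, n⟫ = 1 := by rw [real_inner_self_eq_norm_sq, norm_unitNormal hgrad, one_pow]
  have hPn : projector φ x n = 0 := by
    rw [projector_apply, ← hn', hnn, one_smul, sub_self]
  have hNn : N x n = 0 := by
    rw [← hNtan]
    simp [hPn]
  have hσn : stress φ N S x n = 0 := by
    rw [stress, _root_.add_apply, hNn, dyad_apply, hStan, zero_smul, add_zero]
  have hσP : (stress φ N S x).comp (projector φ x) = N x + dyad n (S x) := by
    ext v : 1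
    rw [ContinuousLinearMap.comp_apply, projector_apply, map_sub, map_smul, ← hn', hσn, smul_zero,
      sub_zero, stress]
  have hdy : crossVec (transp (N x + dyad n (S x))) = crossVec (transp (N x)) + cross (S x) n := by
    have hadd : transp (N x + dyad n (S x)) = transp (N x) + transp (dyad n (S x)) :=
      map_add _ _ _
    rw [hadd, crossVec_add]
    congr 1
    apply ext_three <;>
      simp only [crossVec_apply_zero, crossVec_apply_one, crossVec_apply_two, transp_apply,
        dyad_apply, PiLp.smul_apply, inner_e, smul_eq_mul, cross_coords]
  have hcross : cross n (surfaceDiv φ M x) = cross n (S x) := by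
    rw [hshear, projector_apply, ← hn']
    apply ext_three <;>
      simp only [cross_coords, PiLp.sub_apply, PiLp.smul_apply, smul_eq_mul] <;>
      ring
  have hanti : cross n (S x) + cross (S x) n = 0 := by
    apply ext_three <;>
      simp only [cross_coords, PiLp.add_apply, PiLp.zero_apply] <;> ring
  rw [surfaceDiv_momentTensor hn hM hσ, ← hn', hσP, hdy, hcross, crossVec_add]
  calc _ = crossVec (-((weingarten φ x).comp (transp (M x)))) + crossVec (transp (N x))
        + cross x (surfaceDiv φ (stress φ N S) x) + (cross n (S x) + cross (S x) n) := by abel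
    _ = _ := by rw [hanti, add_zero]

theorem momentEquilibrium_of_crossVec_eq_zero (hab : ∀ i, a i < b i) (hφ : Continuous φ)
    (hU : IsOpen U) (hΩU : midSurface φ a b ⊆ U) (hφ2 : ContDiffOn ℝ 2 φ U)
    (hgrad : ∀ x ∈ U, gradient φ x ≠ 0) (htrans : Transversal φ a b)
    {N M : E3 → Tensor2} {S f : E3 → E3}
    (hN : ContDiffOn ℝ 1 N U) (hM : ContDiffOn ℝ 1 M U) (hS : ContDiffOn ℝ 1 S U)
    (hNtan : TangentialOn φ N (midSurface φ a b))
    (hStan : ∀ x ∈ midSurface φ a b, ⟪S x, unitNormal φ x⟫ = 0)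
    (hforce : ForceEquilibrium φ a b N S f)
    (hshear : ∀ x ∈ midSurface φ a b, S x = projector φ x (surfaceDiv φ M x))
    (hsymm : ∀ x ∈ midSurface φ a b,
      crossVec (-((weingarten φ x).comp (transp (M x))) + transp (N x)) = 0) :
    MomentEquilibrium φ a b N M S f := by
  have hn := contDiffOn_unitNormal hU hφ2 hgrad
  have hσ := contDiffOn_stress hn hN hS
  have hQ : ContDiffOn ℝ 1 (momentTensor φ N M S) U :=
    ((crossL.contDiff.comp_contDiffOn hn).clm_comp hM).add
      (crossL.contDiff.contDiffOn.clm_comp hσ)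
  obtain ⟨hi1, hi2, heq⟩ := setIntegral_apply_conormal_eq_setIntegral_surfaceDiv hab hφ hU hΩU hφ2
    hgrad htrans hQ
  have hm := (isClosed_midSurface hφ a b).measurableSet
  have hpt : EqOn (surfaceDiv φ (momentTensor φ N M S)) (fun x => -cross x (f x))
      (midSurface φ a b) := by
    intro x hx
    have hxU := hU.mem_nhds (hΩU hx)
    rw [surfaceDiv_momentTensor_eq ((hn.contDiffAt hxU).differentiableAt one_ne_zero)
      ((hM.contDiffAt hxU).differentiableAt one_ne_zero)
      ((hσ.contDiffAt hxU).differentiableAt one_ne_zero) (hgrad x (hΩU hx)) (hNtan x hx)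
      (hStan x hx) (hshear x hx), hsymm x hx, zero_add, eq_neg_of_add_eq_zero_left (hforce x hx)]
    simp only [← crossL_apply, map_neg]
  have hi3 : IntegrableOn (fun x => cross x (f x)) (midSurface φ a b) μHE[2] := by
    simpa using (hi2.congr_fun hpt hm).neg
  refine ⟨hi1, hi3, ?_⟩
  have h1 : ∫ x in boundaryCurve φ a b,
      (boundaryMoment φ a b M x + cross x (traction φ a b N S x)) ∂μHE[1]
      = ∫ x in midSurface φ a b, surfaceDiv φ (momentTensor φ N M S) x ∂μHE[2] := heq
  rw [h1, setIntegral_congr_fun hm hpt, integral_neg, neg_add_cancel]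

end Moment
end Shell

theorem mainTheorem3
    -- the mid-surface, the zero level set of `φ` in the cuboid with opposite vertices `a`, `b`
    (φ : Shell.E3 → ℝ) (a b : Shell.E3) (hab : ∀ i, a i < b i)
    (hφ : Continuous φ)
    (U : Set Shell.E3) (hU : IsOpen U) (hΩU : Shell.midSurface φ a b ⊆ U)
    (hφ2 : ContDiffOn ℝ 2 φ U) (hgrad : ∀ x ∈ U, gradient φ x ≠ 0)
    (htrans : Shell.Transversal φ a b)
    -- tangential stress tensor, moment tensor, transverse shear vector and surface load
    (N M : Shell.E3 → Shell.Tensor2) (S f : Shell.E3 → Shell.E3)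
    (hN : ContDiffOn ℝ 1 N U) (hM : ContDiffOn ℝ 1 M U) (hS : ContDiffOn ℝ 1 S U)
    (hNtan : Shell.TangentialOn φ N (Shell.midSurface φ a b))
    (hMtan : Shell.TangentialOn φ M (Shell.midSurface φ a b))
    (hStan : ∀ x ∈ Shell.midSurface φ a b, inner ℝ (S x) (Shell.unitNormal φ x) = 0)
    (hforce : Shell.ForceEquilibrium φ a b N S f)
    -- the transverse shear condition
    (hshear : ∀ x ∈ Shell.midSurface φ a b,
      S x = Shell.projector φ x (Shell.surfaceDiv φ M x)) :
    ((∀ x ∈ Shell.midSurface φ a b, Shell.transp (M x) = M x) →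
      (∀ x ∈ Shell.midSurface φ a b,
        Shell.crossVec (-((Shell.weingarten φ x).comp (M x)) + Shell.transp (N x)) = 0) →
      Shell.MomentEquilibrium φ a b N M S f) ∧
    ((∀ x ∈ Shell.midSurface φ a b,
        Shell.crossVec
          (-((Shell.weingarten φ x).comp (Shell.transp (M x))) + Shell.transp (N x)) = 0) →
      Shell.MomentEquilibrium φ a b N M S f) := by

  have main := Shell.momentEquilibrium_of_crossVec_eq_zero hab hφ hU hΩU hφ2 hgrad htrans hN hM hS
    hNtan hStan hforce hshear
  refine ⟨fun hsym h => main fun x hx => ?_, main⟩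
  rw [hsym x hx]
  exact h x hx
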